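/- Let $\mathbb{K}$ be a field, $\ell\ge 0$ an integer, and $Q$ the quiver of type $\mathbb{A}_\ell$ with vertices $x_0,\dots,x_\ell$ and orientation $\tau=(\tau_1,\dots,\tau_\ell)\in\{0,1\}^\ell$: for each $1\le i\le \ell$ there is exactly one arrow $e_i$ between $x_{i-1}$ and $x_i$, namely $x_{i-1}\to x_i$ if $\tau_i=1$ and $x_i\to x_{i-1}$ if $\tau_i=0$. Let $\mathbf{Rep}(Q)$ be the category of finite-dimensional representations of $Q$ over $\mathbb{K}$. A central charge is a function $\alpha:\{x_0,\dots,x_\ell\}\to\mathbb{R}$. The $\alpha$-slope of a representation $V\ne 0$ is $\mu_\alpha(V)=\frac{\sum_i\alpha(x_i)\dim V_{x_i}}{\sum_i\dim V_{x_i}}$, and $V\neq 0$ is $\alpha$-semistable if $\mu_\alpha(U)\le\mu_\alpha(V)$ for every subrepresentation $0\ne U\subset V$. The Harder-Narasimhan (HN) type of $V$ along $\alpha$ is the list $(\underline{\dim}\,S^1,\dots,\underline{\dim}\,S^n)$ of the dimension vectors of the successive quotients $S^i=V^i/V^{i-1}$ of the unique filtration $0=V^0\subsetneq V^1\subsetneq\dots\subsetneq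 V^n=V$ by subrepresentations whose successive quotients are $\alpha$-semistable with $\mu_\alpha(S^1)>\dots>\mu_\alpha(S^n)$ (the empty list for $V=0$). The central charge $\alpha$ is complete for $Q$ if any two representations in $\mathbf{Rep}(Q)$ with the same HN type along $\alpha$ are isomorphic. For $0\le a\le b\le\ell$ let $\mathbf{I}_\tau[a,b]$ be the interval module, which is $\mathbb{K}$ at $x_a,\dots,x_b$ and $0$ at every other vertex, with the identity on each arrow between two copies of $\mathbb{K}$ and zero maps elsewhere. For $0\le i\le \ell$ let $\chi(i)=\#\{j\le i\mid\tau_j=1\}$ and $\eta(i)=\#\{j\le i\mid\tau_j=0\}$, and write the level sets of these monotone functions as $\{i\mid\chi(i)=k\}=[a_k,b_k]$ for $0\le k\le\chi(\ell)$ and $\{i\mid\eta(i)=k\}=[a'_k,b'_k]$ for $0\le k\le\eta(\ell)$. Theorem. The set of complete central charges for $Q$ is nonempty, and a central charge $\alpha$ is complete for $Q$ if and only if both chains of inequalities $$\mu_\alpha(\mathbf{I}_\tau[a_0,b_0])>\mu_\alpha(\mathbf{I}_\tau[a_1,b_1])>\cdots>\mu_\alpha(\mathbf{I}_\tau[a_{\chi(\ell)},b_{\chi(\ell)}]),$$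 $$\mu_\alpha(\mathbf{I}_\tau[a'_0,b'_0])<\mu_\alpha(\mathbf{I}_\tau[a'_1,b'_1])<\cdots<\mu_\alpha(\mathbf{I}_\tau[a'_{\eta(\ell)},b'_{\eta(\ell)}])$$ hold. In particular, if $Q$ is equioriented (all $\tau_i=1$), then $\alpha$ is complete for $Q$ if and only if $\alpha(x_i)>\alpha(x_{i+1})$ for all $0\le i<\ell$. -/

import Mathlib

universe u v w

noncomputable section

/-- A finite-dimensional `K`-linear representation of a quiver `Q`. -/
structure QuiverRep (K : Type u) [Field K] (Q : Type v) [Quiver.{w} Q] where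
  /-- the vector space at a vertex -/
  obj : Q → Type u
  [addCommGroup : ∀ x, AddCommGroup (obj x)]
  [module : ∀ x, Module K (obj x)]
  [finiteDimensional : ∀ x, FiniteDimensional K (obj x)]
  /-- the linear map of an arrow -/
  map : ∀ {x y : Q}, (x ⟶ y) → (obj x →ₗ[K] obj y)

attribute [instance] QuiverRep.addCommGroup QuiverRep.module QuiverRep.finiteDimensional

namespace QuiverRep

variable {K : Type u} [Field K] {Q : Type v} [Quiver.{w} Q]

/-- Two representations are isomorphic: there is a family of linear isomorphisms, one for each
vertex, which commutes with the maps of all arrows. -/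
def Isomorphic (V W : QuiverRep K Q) : Prop :=
  ∃ φ : ∀ x, V.obj x ≃ₗ[K] W.obj x,
    ∀ (x y : Q) (e : x ⟶ y) (v : V.obj x), φ y (V.map e v) = W.map e (φ x v)

/-- The dimension vector. -/
def dimVec (V : QuiverRep K Q) : Q → ℕ := fun x => Module.finrank K (V.obj x)

/-- A representation is nonzero if one of its vector spaces is. -/
def IsNonzero (V : QuiverRep K Q) : Prop := ∃ x, Nontrivial (V.obj x)

/-- The slope of a (nonzero) representation along the central charge `α`. -/
def slope [Fintype Q] (α : Q → ℝ) (V : QuiverRep K Q) : ℝ :=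
  (∑ x, α x * (V.dimVec x : ℝ)) / (∑ x, (V.dimVec x : ℝ))

/-- A subrepresentation: a family of subspaces which is preserved by the maps of all arrows. -/
@[ext]
structure Subrep (V : QuiverRep K Q) where
  /-- the subspace at a vertex -/
  carrier : ∀ x, Submodule K (V.obj x)
  map_mem : ∀ {x y : Q} (e : x ⟶ y) (v : V.obj x), v ∈ carrier x → V.map e v ∈ carrier y

namespace Subrep

variable {V : QuiverRep K Q}

/-- Inclusion of subrepresentations is inclusion at every vertex. -/
instance : PartialOrder (Subrep V) :=
  PartialOrder.lift Subrep.carrier (fun _ _ h => Subrep.ext h)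

/-- The zero subrepresentation. -/
instance : Bot (Subrep V) where
  bot :=
    { carrier := fun _ => ⊥
      map_mem := fun e v hv => by
        rw [Submodule.mem_bot] at hv ⊢
        rw [hv, map_zero] }

/-- The whole representation. -/
instance : Top (Subrep V) where
  top :=
    { carrier := fun _ => ⊤
      map_mem := fun _ _ _ => Submodule.mem_top }

/-- A subrepresentation, regarded as a representation. -/
def toRep (U : Subrep V) : QuiverRep K Q where
  obj x := U.carrier x
  map {x y} e := (V.map e).restrict (p := U.carrier x) (q := U.carrier y) (U.map_mem e)

/-- The quotient representation `V / U`. -/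
def quotient (U : Subrep V) : QuiverRep K Q where
  obj x := V.obj x ⧸ U.carrier x
  map {x y} e := (U.carrier x).mapQ (U.carrier y) (V.map e) (U.map_mem e)

/-- The intersection of `U` with `W`, regarded as a subrepresentation of `W`. For `U ≤ W` this is
`U` itself, inside `W`. -/
def restrict (U W : Subrep V) : Subrep W.toRep where
  carrier x := (U.carrier x).comap (W.carrier x).subtype
  map_mem e v hv := U.map_mem e v.1 hv

/-- The subquotient `W / U`, for `U ≤ W`. -/
def subquotient (U W : Subrep V) : QuiverRep K Q := (U.restrict W).quotient

end Subrep

variable [Fintype Q]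

/-- `V` is `α`-semistable: it is nonzero, and no nonzero subrepresentation has a larger slope. -/
def IsSemistable (α : Q → ℝ) (V : QuiverRep K Q) : Prop :=
  V.IsNonzero ∧ ∀ U : Subrep V, U ≠ ⊥ → slope α U.toRep ≤ slope α V

/-- `0 = F 0 ⊊ F 1 ⊊ ⋯ ⊊ F n = V` is a Harder-Narasimhan filtration of `V` along `α`: the
successive quotients are semistable and have strictly decreasing slopes. (The zero representation
has exactly one such filtration, of length `0`.) -/
structure IsHNFiltration (α : Q → ℝ) (V : QuiverRep K Q) {n : ℕ} (F : Fin (n + 1) → Subrep V) :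
    Prop where
  bot : F 0 = ⊥
  top : F (Fin.last n) = ⊤
  strictMono : StrictMono F
  semistable : ∀ i : Fin n, IsSemistable α ((F i.castSucc).subquotient (F i.succ))
  slope_strictAnti : StrictAnti fun i : Fin n => slope α ((F i.castSucc).subquotient (F i.succ))

/-- `T` is the Harder-Narasimhan type of `V` along `α`: the list of the dimension vectors of the
successive quotients of the Harder-Narasimhan filtration of `V`. -/
def IsHNType (α : Q → ℝ) (V : QuiverRep K Q) (T : List (Q → ℕ)) : Prop :=
  ∃ (n : ℕ) (F : Fin (n + 1) → Subrep V), IsHNFiltration α V F ∧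
    T = List.ofFn fun i : Fin n => dimVec ((F i.castSucc).subquotient (F i.succ))

end QuiverRep

/-- The central charge `α` is complete for `Q` (over the field `K`): any two finite-dimensional
representations with the same Harder-Narasimhan type along `α` are isomorphic. -/
def IsCompleteCharge (K : Type u) [Field K] {Q : Type v} [Quiver.{w} Q] [Fintype Q]
    (α : Q → ℝ) : Prop :=
  ∀ V W : QuiverRep K Q,
    (∃ T : List (Q → ℕ), V.IsHNType α T ∧ W.IsHNType α T) → V.Isomorphic W

/-- The vertices `x_0, …, x_ℓ` of the type `A_ℓ` quiver of orientation `τ`. The edge between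
`x_i` and `x_{i+1}` has the orientation `τ i`, for `i : Fin ℓ`. -/
def TypeA {ℓ : ℕ} (_τ : Fin ℓ → Bool) : Type := Fin (ℓ + 1)

namespace TypeA

/-- The arrows of the type `A_ℓ` quiver: for each `i : Fin ℓ` there is one arrow, which is
`x_i ⟶ x_{i+1}` if `τ i = true` and `x_{i+1} ⟶ x_i` if `τ i = false`. -/
inductive Arrow {ℓ : ℕ} (τ : Fin ℓ → Bool) : Fin (ℓ + 1) → Fin (ℓ + 1) → Type
  | forward (i : Fin ℓ) (h : τ i = true) : Arrow τ i.castSucc i.succ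
  | backward (i : Fin ℓ) (h : τ i = false) : Arrow τ i.succ i.castSucc

variable {ℓ : ℕ} {τ : Fin ℓ → Bool}

instance : Quiver (TypeA τ) := ⟨Arrow τ⟩

instance : Fintype (TypeA τ) := inferInstanceAs (Fintype (Fin (ℓ + 1)))

instance : LinearOrder (TypeA τ) := inferInstanceAs (LinearOrder (Fin (ℓ + 1)))

instance : BoundedOrder (TypeA τ) := inferInstanceAs (BoundedOrder (Fin (ℓ + 1)))

/-- The vertex `x_i`. -/
def vertex (τ : Fin ℓ → Bool) (i : Fin (ℓ + 1)) : TypeA τ := i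

/-- The interval module of `[a, b]`: at a vertex of `[a, b]` the vector space is `K` (functions
from a one-point type to `K`), at any other vertex it is zero (functions from an empty type).
The map of an arrow is the identity of `K` if both ends lie in `[a, b]`, and zero otherwise. -/
def intervalModule (K : Type u) [Field K] (τ : Fin ℓ → Bool) (a b : TypeA τ) :
    QuiverRep K (TypeA τ) where
  obj x := PLift (a ≤ x ∧ x ≤ b) → K
  map {x y} _ :=
    { toFun := fun f _ => if h : a ≤ x ∧ x ≤ b then f ⟨h⟩ else 0
      map_add' := fun f g => by
        funext _
        by_cases h : a ≤ x ∧ x ≤ b <;> simp [h]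
      map_smul' := fun c f => by
        funext _
        by_cases h : a ≤ x ∧ x ≤ b <;> simp [h] }

/-- `χ(x_i)` is the number of forward edges among the first `i` edges. -/
def chi (τ : Fin ℓ → Bool) (x : TypeA τ) : ℕ :=
  Fin.induction (motive := fun _ => ℕ) 0 (fun i c => if τ i = true then c + 1 else c) x

/-- `η(x_i)` is the number of backward edges among the first `i` edges. -/
def eta (τ : Fin ℓ → Bool) (x : TypeA τ) : ℕ :=
  Fin.induction (motive := fun _ => ℕ) 0 (fun i c => if τ i = false then c + 1 else c) x

/-- The first vertex of the level set `{x | f x = k}`, if that is nonempty. -/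
def levelMin (f : TypeA τ → ℕ) (k : ℕ) : TypeA τ := (Finset.univ.filter fun x => f x = k).inf id

/-- The last vertex of the level set `{x | f x = k}`, if that is nonempty. -/
def levelMax (f : TypeA τ → ℕ) (k : ℕ) : TypeA τ := (Finset.univ.filter fun x => f x = k).sup id

/-- The interval module of the interval `[levelMin f k, levelMax f k]`; for monotone `f` that
interval is the level set `{x | f x = k}`. -/
def levelModule (K : Type u) [Field K] (f : TypeA τ → ℕ) (k : ℕ) : QuiverRep K (TypeA τ) :=
  intervalModule K τ (levelMin f k) (levelMax f k)

end TypeA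

end

noncomputable section

/-! ### Lattice of subrepresentations, charges and semistable subquotients -/

namespace QuiverRep

variable {K : Type u} [Field K] {Q : Type v} [Quiver.{w} Q]

namespace Subrep

variable {V : QuiverRep K Q}

/-- The intersection of two subrepresentations. -/
instance : Min (Subrep V) where
  min A B :=
    { carrier := fun x => A.carrier x ⊓ B.carrier x
      map_mem := fun e v hv => ⟨A.map_mem e v hv.1, B.map_mem e v hv.2⟩ }

/-- The sum of two subrepresentations. -/
instance : Max (Subrep V) where
  max A B :=
    { carrier := fun x => A.carrier x ⊔ B.carrier x
      map_mem := fun e v hv => by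
        obtain ⟨a, ha, b, hb, rfl⟩ := Submodule.mem_sup.1 hv
        rw [map_add]
        exact Submodule.add_mem_sup (A.map_mem e a ha) (B.map_mem e b hb) }

theorem inf_carrier (A B : Subrep V) (x : Q) :
    (A ⊓ B).carrier x = A.carrier x ⊓ B.carrier x := rfl

theorem sup_carrier (A B : Subrep V) (x : Q) :
    (A ⊔ B).carrier x = A.carrier x ⊔ B.carrier x := rfl

theorem bot_carrier (x : Q) : (⊥ : Subrep V).carrier x = ⊥ := rfl

theorem top_carrier (x : Q) : (⊤ : Subrep V).carrier x = ⊤ := rfl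

theorem dimVec_subquotient {A B : Subrep V} (h : A ≤ B) (x : Q) :
    dimVec (A.subquotient B) x + Module.finrank K (A.carrier x) =
      Module.finrank K (B.carrier x) := by
  have h1 := Submodule.finrank_quotient_add_finrank
    ((A.carrier x).comap (B.carrier x).subtype)
  have h2 : Module.finrank K ((A.carrier x).comap (B.carrier x).subtype) =
      Module.finrank K (A.carrier x) :=
    (Submodule.comapSubtypeEquivOfLe (h x)).finrank_eq
  rw [h2] at h1
  exact h1

/-- The subrepresentation of `B / A` which is the image of `M`. -/
def toSubquotient (A B M : Subrep V) : Subrep (A.subquotient B) where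
  carrier x := ((M.carrier x).comap (B.carrier x).subtype).map
    ((A.carrier x).comap (B.carrier x).subtype).mkQ
  map_mem e v hv := by
    obtain ⟨m, hm, rfl⟩ := hv
    exact ⟨⟨V.map e m.1, B.map_mem e m.1 m.2⟩, M.map_mem e m.1 hm, rfl⟩

/-- The subrepresentation between `A` and `B` which corresponds to a subrepresentation of
`B / A`. -/
def ofSubquotient (A B : Subrep V) (N : Subrep (A.subquotient B)) : Subrep V where
  carrier x := ((N.carrier x).comap
    ((A.carrier x).comap (B.carrier x).subtype).mkQ).map (B.carrier x).subtype
  map_mem e v hv := by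
    obtain ⟨m, hm, rfl⟩ := hv
    exact ⟨⟨V.map e m.1, B.map_mem e m.1 m.2⟩, N.map_mem e _ hm, rfl⟩

theorem finrank_toSubquotient {A B M : Subrep V} (h1 : A ≤ M) (h2 : M ≤ B) (x : Q) :
    Module.finrank K ((toSubquotient A B M).carrier x) + Module.finrank K (A.carrier x) =
      Module.finrank K (M.carrier x) := by
  have h3 := LinearMap.finrank_range_add_finrank_ker
    (((A.carrier x).comap (B.carrier x).subtype).mkQ.domRestrict
      ((M.carrier x).comap (B.carrier x).subtype))
  have h4 : (A.carrier x).comap (B.carrier x).subtype ≤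
      (M.carrier x).comap (B.carrier x).subtype := Submodule.comap_mono (h1 x)
  rw [LinearMap.range_domRestrict, LinearMap.ker_domRestrict, Submodule.ker_mkQ,
    (Submodule.comapSubtypeEquivOfLe h4).finrank_eq,
    (Submodule.comapSubtypeEquivOfLe (h2 x)).finrank_eq,
    (Submodule.comapSubtypeEquivOfLe ((h1 x).trans (h2 x))).finrank_eq] at h3
  exact h3

theorem le_ofSubquotient {A B : Subrep V} (h : A ≤ B) (N : Subrep (A.subquotient B)) :
    A ≤ ofSubquotient A B N := by
  intro x v hv
  refine ⟨⟨v, h x hv⟩, ?_, rfl⟩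
  have : ((A.carrier x).comap (B.carrier x).subtype).mkQ ⟨v, h x hv⟩ = 0 := by
    rw [Submodule.mkQ_apply, Submodule.Quotient.mk_eq_zero]
    exact hv
  change ((A.carrier x).comap (B.carrier x).subtype).mkQ ⟨v, h x hv⟩ ∈ N.carrier x
  rw [this]
  exact zero_mem _

theorem ofSubquotient_le (A B : Subrep V) (N : Subrep (A.subquotient B)) :
    ofSubquotient A B N ≤ B := by
  rintro x _ ⟨m, -, rfl⟩
  exact m.2

theorem toSubquotient_ofSubquotient (A B : Subrep V) (N : Subrep (A.subquotient B)) :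
    toSubquotient A B (ofSubquotient A B N) = N := by
  ext x v
  constructor
  · rintro ⟨m, ⟨m', hm', h⟩, rfl⟩
    rw [Submodule.subtype_injective _ h] at hm'
    exact hm'
  · intro hv
    obtain ⟨m, rfl⟩ := Submodule.mkQ_surjective _ v
    exact ⟨m, ⟨m, hv, rfl⟩, rfl⟩

variable [Fintype Q]

/-- The total charge of a subrepresentation with respect to `α - t`. -/
def charge (α : Q → ℝ) (t : ℝ) (A : Subrep V) : ℝ :=
  ∑ x, (α x - t) * (Module.finrank K (A.carrier x) : ℝ)

/-- Dimension is modular on subspaces. This identity takes the place of the second isomorphism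
theorem, so that slope arguments can stay inside the lattice of one representation. -/
theorem charge_inf_add_charge_sup (α : Q → ℝ) (t : ℝ) (A B : Subrep V) :
    charge α t (A ⊓ B) + charge α t (A ⊔ B) = charge α t A + charge α t B := by
  simp only [charge, ← Finset.sum_add_distrib, ← mul_add, inf_carrier, sup_carrier]
  refine Finset.sum_congr rfl fun x _ => ?_
  have := Submodule.finrank_sup_add_finrank_inf_eq (A.carrier x) (B.carrier x)
  have h : (Module.finrank K ↥(A.carrier x ⊔ B.carrier x) : ℝ) +
      Module.finrank K ↥(A.carrier x ⊓ B.carrier x) =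
      Module.finrank K (A.carrier x) + Module.finrank K (B.carrier x) := by exact_mod_cast this
  rw [add_comm, ← h]

/-- The subquotient `B / A` has slope `t` (or is zero), and no subrepresentation of it has a
larger slope. -/
def SemistableBetween (α : Q → ℝ) (t : ℝ) (A B : Subrep V) : Prop :=
  charge α t B = charge α t A ∧ ∀ M, A ≤ M → M ≤ B → charge α t M ≤ charge α t A

/-- There is no nonzero map from a semistable subquotient to one of smaller slope. -/
theorem SemistableBetween.le_of_slope_lt {α : Q → ℝ} {p q : ℝ} {A B C D : Subrep V}
    (h1 : SemistableBetween α p A B) (h2 : SemistableBetween α q C D) (hpq : q < p)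
    (hAB : A ≤ B) (hAC : A ≤ C) (hCD : C ≤ D) (hBD : B ≤ D) : B ≤ C := by
  have i1 := h1.2 (B ⊓ C) (fun x => le_inf (hAB x) (hAC x)) (fun x => inf_le_left)
  have i2 := h2.2 (B ⊔ C) (fun x => le_sup_right) (fun x => sup_le (hBD x) (hCD x))
  have i3 := charge_inf_add_charge_sup α q B C
  -- The quotient `B / (B ⊓ C)` has nonnegative charge for `p`, by semistability of `B / A`, and
  -- nonpositive charge for `q`, by modularity and semistability of `D / C`. The two charges differ
  -- by `p - q` times its dimension, so this dimension is zero.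
  have i4 : (charge α q B - charge α q (B ⊓ C)) - (charge α p B - charge α p (B ⊓ C)) =
      ∑ x, (p - q) * ((Module.finrank K (B.carrier x) : ℝ) -
        Module.finrank K ((B ⊓ C).carrier x)) := by
    simp only [charge, ← Finset.sum_sub_distrib]
    exact Finset.sum_congr rfl fun x _ => by ring
  have hle : ∀ x, Module.finrank K ((B ⊓ C).carrier x) ≤ Module.finrank K (B.carrier x) :=
    fun x => Submodule.finrank_mono inf_le_left
  have hnn : ∀ x ∈ Finset.univ, 0 ≤ (p - q) * ((Module.finrank K (B.carrier x) : ℝ) -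
        Module.finrank K ((B ⊓ C).carrier x)) := fun x _ =>
    mul_nonneg (by linarith) (sub_nonneg.2 (by exact_mod_cast hle x))
  have hz := (Finset.sum_eq_zero_iff_of_nonneg hnn).1
    (le_antisymm (by rw [← i4]; linarith [h1.1]) (Finset.sum_nonneg hnn))
  intro x
  have hx := hz x (Finset.mem_univ x)
  have hx2 : Module.finrank K ((B ⊓ C).carrier x) = Module.finrank K (B.carrier x) := by
    rcases mul_eq_zero.1 hx with h | h
    · linarith
    · exact_mod_cast (sub_eq_zero.1 h).symm
  have := Submodule.eq_of_le_of_finrank_eq (inf_le_left : (B ⊓ C).carrier x ≤ B.carrier x) hx2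
  rw [← this]
  exact inf_le_right

end Subrep

theorem isNonzero_iff (V : QuiverRep K Q) : V.IsNonzero ↔ ∃ x, V.dimVec x ≠ 0 :=
  exists_congr fun x => by
    rw [← Module.finrank_pos_iff (R := K) (M := V.obj x), Nat.pos_iff_ne_zero]
    rfl

section

variable {Q : Type v} [Fintype Q]

/-- The slope, as a function of the dimension vector. -/
def slopeVec (α : Q → ℝ) (d : Q → ℕ) : ℝ := (∑ x, α x * (d x : ℝ)) / (∑ x, (d x : ℝ))

theorem sum_pos_of_ne_zero {d : Q → ℕ} {x : Q} (h : d x ≠ 0) : 0 < ∑ x, (d x : ℝ) :=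
  Finset.sum_pos' (fun _ _ => Nat.cast_nonneg _)
    ⟨x, Finset.mem_univ x, by exact_mod_cast Nat.pos_of_ne_zero h⟩

theorem sum_sub_mul_eq (α : Q → ℝ) (d : Q → ℕ) (t : ℝ) :
    ∑ x, (α x - t) * (d x : ℝ) = (∑ x, α x * (d x : ℝ)) - t * ∑ x, (d x : ℝ) := by
  rw [Finset.mul_sum, ← Finset.sum_sub_distrib]
  exact Finset.sum_congr rfl fun x _ => by ring

theorem slopeVec_le_iff (α : Q → ℝ) {d : Q → ℕ} {x : Q} (h : d x ≠ 0) (t : ℝ) :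
    slopeVec α d ≤ t ↔ ∑ x, (α x - t) * (d x : ℝ) ≤ 0 := by
  rw [slopeVec, div_le_iff₀ (sum_pos_of_ne_zero h), sum_sub_mul_eq, sub_nonpos]

theorem slopeVec_eq_iff (α : Q → ℝ) {d : Q → ℕ} {x : Q} (h : d x ≠ 0) (t : ℝ) :
    slopeVec α d = t ↔ ∑ x, (α x - t) * (d x : ℝ) = 0 := by
  rw [slopeVec, div_eq_iff (sum_pos_of_ne_zero h).ne', sum_sub_mul_eq, sub_eq_zero]

end

variable [Fintype Q]

theorem slope_eq_slopeVec (α : Q → ℝ) (V : QuiverRep K Q) : slope α V = slopeVec α V.dimVec := rfl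

namespace Subrep

variable {V : QuiverRep K Q}

theorem charge_sub_charge (α : Q → ℝ) (t : ℝ) {A B : Subrep V} {d : Q → ℕ}
    (h : ∀ x, d x + Module.finrank K (A.carrier x) = Module.finrank K (B.carrier x)) :
    charge α t B - charge α t A = ∑ x, (α x - t) * (d x : ℝ) := by
  simp only [charge, ← Finset.sum_sub_distrib]
  refine Finset.sum_congr rfl fun x _ => ?_
  rw [← h x]
  push_cast
  ring

theorem exists_dimVec_ne_zero {A B : Subrep V} (h : A < B) :
    ∃ x, dimVec (A.subquotient B) x ≠ 0 := by
  by_contra! hc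
  refine h.ne (Subrep.ext (funext fun x => ?_))
  refine Submodule.eq_of_le_of_finrank_eq (h.le x) ?_
  have := dimVec_subquotient h.le x
  rw [hc x] at this
  omega

theorem slope_subquotient_eq_iff (α : Q → ℝ) (t : ℝ) {A B : Subrep V} (h : A < B) :
    slope α (A.subquotient B) = t ↔ charge α t B = charge α t A := by
  obtain ⟨x, hx⟩ := exists_dimVec_ne_zero h
  rw [slope_eq_slopeVec, slopeVec_eq_iff α hx,
    ← charge_sub_charge α t (dimVec_subquotient h.le), sub_eq_zero]

/-- Subrepresentations of `B / A` correspond to those between `A` and `B`, and clearing denominators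
turns a comparison of slopes into a sign of a charge. Quotient representations need not be handled
after this. -/
theorem isSemistable_subquotient_iff (α : Q → ℝ) {A B : Subrep V} (h : A < B) :
    IsSemistable α (A.subquotient B) ↔
      SemistableBetween α (slope α (A.subquotient B)) A B := by
  have hne := exists_dimVec_ne_zero h
  have heq := (slope_subquotient_eq_iff α _ h).1 rfl
  constructor
  · rintro ⟨-, h2⟩
    refine ⟨heq, fun M hAM hMB => ?_⟩
    -- Semistability says nothing about the zero subrepresentation, but then `M` has the dimensions,
    -- hence the charge, of `A`.
    by_cases hM : toSubquotient A B M = ⊥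
    · have h3 : ∀ x, 0 + Module.finrank K (A.carrier x) = Module.finrank K (M.carrier x) := by
        intro x
        rw [← finrank_toSubquotient hAM hMB x, hM, bot_carrier, finrank_bot]
      have := charge_sub_charge α (slope α (A.subquotient B)) (d := fun _ => 0) h3
      simp at this
      linarith
    · have h3 := h2 _ hM
      have h4 : ∃ x, (toSubquotient A B M).toRep.dimVec x ≠ 0 := by
        by_contra! hc
        exact hM (Subrep.ext (funext fun x => Submodule.finrank_eq_zero.1 (hc x)))
      obtain ⟨x, hx⟩ := h4
      have h5 : ∀ x, (toSubquotient A B M).toRep.dimVec x + Module.finrank K (A.carrier x) =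
          Module.finrank K (M.carrier x) := fun x => finrank_toSubquotient hAM hMB x
      rw [slope_eq_slopeVec, slopeVec_le_iff α hx, ← charge_sub_charge α _ h5] at h3
      linarith
  · rintro ⟨-, h2⟩
    refine ⟨(isNonzero_iff _).2 hne, fun N hN => ?_⟩
    have h3 := h2 _ (le_ofSubquotient h.le N) (ofSubquotient_le A B N)
    have h4 : ∃ x, N.toRep.dimVec x ≠ 0 := by
      by_contra! hc
      exact hN (Subrep.ext (funext fun x => Submodule.finrank_eq_zero.1 (hc x)))
    obtain ⟨x, hx⟩ := h4
    have h5 : ∀ x, N.toRep.dimVec x + Module.finrank K (A.carrier x) =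
        Module.finrank K ((ofSubquotient A B N).carrier x) := fun x => by
      rw [← finrank_toSubquotient (le_ofSubquotient h.le N) (ofSubquotient_le A B N),
        toSubquotient_ofSubquotient]
      rfl
    rw [slope_eq_slopeVec, slopeVec_le_iff α hx, ← charge_sub_charge α _ h5]
    linarith

end Subrep

open Subrep

/-- The Harder-Narasimhan type of an extension of two semistable representations whose slopes do
not increase. -/
theorem isHNType_of_two_step {α : Q → ℝ} {V : QuiverRep K Q} {R : Subrep V} {p q : ℝ}
    (h0 : ⊥ < R) (h1 : R < ⊤) (hp : SemistableBetween α p ⊥ R) (hq : SemistableBetween α q R ⊤)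
    (hqp : q ≤ p) {d₁ d₂ : Q → ℕ} (hd₁ : ∀ x, Module.finrank K (R.carrier x) = d₁ x)
    (hd₂ : ∀ x, V.dimVec x = d₁ x + d₂ x) :
    V.IsHNType α (if q < p then [d₁, d₂] else [d₁ + d₂]) := by
  have hp' := (slope_subquotient_eq_iff α p h0).2 hp.1
  have hq' := (slope_subquotient_eq_iff α q h1).2 hq.1
  have hV : ∀ x, Module.finrank K ((⊤ : Subrep V).carrier x) = d₁ x + d₂ x := fun x => by
    rw [← hd₂, top_carrier, finrank_top]
    rfl
  have e1 : dimVec ((⊥ : Subrep V).subquotient R) = d₁ := funext fun x => by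
    have := dimVec_subquotient h0.le x
    rwa [bot_carrier, finrank_bot, add_zero, hd₁] at this
  have e2 : dimVec (R.subquotient ⊤) = d₂ := funext fun x => by
    have := dimVec_subquotient h1.le x
    rw [hd₁, hV] at this
    omega
  have h01 := h0.trans h1
  have e3 : dimVec ((⊥ : Subrep V).subquotient ⊤) = d₁ + d₂ := funext fun x => by
    have := dimVec_subquotient h01.le x
    rwa [bot_carrier, finrank_bot, add_zero, hV] at this
  split_ifs with h
  · refine ⟨2, ![⊥, R, ⊤], ⟨rfl, rfl, ?_, ?_, ?_⟩, ?_⟩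
    · rw [Fin.strictMono_iff_lt_succ]
      intro i
      fin_cases i
      · exact h0
      · exact h1
    · intro i
      fin_cases i
      · exact (isSemistable_subquotient_iff α h0).2 (hp'.symm ▸ hp)
      · exact (isSemistable_subquotient_iff α h1).2 (hq'.symm ▸ hq)
    · rw [Fin.strictAnti_iff_succ_lt]
      intro i
      fin_cases i
      change slope α (R.subquotient ⊤) < slope α ((⊥ : Subrep V).subquotient R)
      rwa [hp', hq']
    · rw [List.ofFn_succ, List.ofFn_succ, List.ofFn_zero]
      change _ = [dimVec ((⊥ : Subrep V).subquotient R), dimVec (R.subquotient ⊤)]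
      rw [e1, e2]
  · obtain rfl : p = q := le_antisymm (not_lt.1 h) hqp
    have hs : charge α p (⊤ : Subrep V) = charge α p ⊥ := hq.1.trans hp.1
    have hs' := (slope_subquotient_eq_iff α p h01).2 hs
    refine ⟨1, ![⊥, ⊤], ⟨rfl, rfl, ?_, ?_, ?_⟩, ?_⟩
    · rw [Fin.strictMono_iff_lt_succ]
      intro i
      fin_cases i
      exact h01
    · intro i
      fin_cases i
      refine (isSemistable_subquotient_iff α h01).2 ?_
      rw [hs']
      refine ⟨hs, fun M _ _ => ?_⟩
      -- With equal slopes the extension is itself semistable: `M ⊓ R` is bounded by semistability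
      -- of `R`, `M ⊔ R` by that of the quotient, and modularity adds the bounds.
      have i1 := charge_inf_add_charge_sup α p M R
      have i2 := hp.2 (M ⊓ R) (fun x => bot_le) (fun x => inf_le_right)
      have i3 := hq.2 (M ⊔ R) (fun x => le_sup_right) (fun x => le_top)
      linarith
    · intro i j hij
      exact absurd hij (by omega)
    · rw [List.ofFn_succ, List.ofFn_zero]
      change _ = [dimVec ((⊥ : Subrep V).subquotient ⊤)]
      rw [e3]

end QuiverRep

/-! ### Polygons of partial sums: chains of level means and chords -/

/-- For every edge `c` with `p c`, the point of the graph of the partial sums of `s` at `c + 1`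
lies strictly above the chord between any two points to its left and right. -/
def AboveChords (p : ℕ → Prop) (s : ℕ → ℝ) (n : ℕ) : Prop :=
  ∀ a c b : ℕ, a ≤ c → c + 1 < b → b ≤ n → p c →
    (∑ j ∈ Finset.Ico (c + 1) b, s j) * (c + 1 - a) <
      (∑ j ∈ Finset.Ico a (c + 1), s j) * (b - (c + 1))

/-- The mean of `s` over a level set of `f`. -/
def levelMean (f : ℕ → ℕ) (s : ℕ → ℝ) (n k : ℕ) : ℝ :=
  (∑ j ∈ Finset.range n with f j = k, s j) / (Finset.card {j ∈ Finset.range n | f j = k} : ℝ)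

/-- The means of `s` over the level sets of the counting function of `p` decrease. -/
def LevelChain (p : ℕ → Prop) [DecidablePred p] (s : ℕ → ℝ) (n : ℕ) : Prop :=
  ∀ k < Nat.count p (n - 1),
    levelMean (Nat.count p) s n (k + 1) < levelMean (Nat.count p) s n k

theorem mul_lt_mul_of_mean_lt {t r L R A B : ℝ} (ht : 0 < t) (hr : 0 < r) (hL : t * A ≤ L)
    (hR : R ≤ r * B) (hBA : B < A) : R * t < L * r :=
  calc R * t ≤ r * B * t := mul_le_mul_of_nonneg_right hR ht.le
    _ = r * t * B := by ring
    _ < r * t * A := mul_lt_mul_of_pos_left hBA (mul_pos hr ht)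
    _ = t * A * r := by ring
    _ ≤ L * r := mul_le_mul_of_nonneg_right hL hr.le

theorem sum_level_eq (f : ℕ → ℕ) (s : ℕ → ℝ) (n k : ℕ) :
    ∑ j ∈ Finset.range n with f j = k, s j =
      ∑ j ∈ Finset.range n with f j = k, levelMean f s n (f j) := by
  have h : ∑ j ∈ Finset.range n with f j = k, levelMean f s n (f j) =
      ∑ j ∈ Finset.range n with f j = k, levelMean f s n k :=
    Finset.sum_congr rfl fun j hj => by rw [(Finset.mem_filter.1 hj).2]
  rw [h, Finset.sum_const, nsmul_eq_mul, levelMean]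
  by_cases h0 : (Finset.filter (fun j => f j = k) (Finset.range n)).card = 0
  · rw [h0, Finset.card_eq_zero.1 h0]
    simp
  · rw [mul_div_cancel₀]
    exact_mod_cast h0

theorem sum_levels_lt_eq (f : ℕ → ℕ) (s : ℕ → ℝ) (n m : ℕ) :
    ∑ j ∈ Finset.range n with f j < m, s j =
      ∑ j ∈ Finset.range n with f j < m, levelMean f s n (f j) := by
  induction m with
  | zero => simp
  | succ m ih =>
    have h : ∀ t : ℕ → ℝ, ∑ j ∈ Finset.range n with f j < m + 1, t j =
        ∑ j ∈ Finset.range n with f j < m, t j + ∑ j ∈ Finset.range n with f j = m, t j := by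
      intro t
      rw [← Finset.sum_union]
      · congr 1
        ext j
        simp only [Finset.mem_filter, Finset.mem_union]
        have : f j < m + 1 ↔ f j < m ∨ f j = m := by omega
        tauto
      · rw [Finset.disjoint_filter]
        intro j _ h1
        omega
    rw [h, h, ih, sum_level_eq]

section

variable (p : ℕ → Prop) [DecidablePred p] (s : ℕ → ℝ) (n : ℕ)

/-- The counting function jumps exactly after an index satisfying `p`, so for these `i` the first
`i` indices form a union of level sets. Thus the polygon with the level means as slopes passes
through the end points and through all points marked by `p`. -/
theorem sum_range_eq_sum_levelMean {i : ℕ} (hi : i ≤ n)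
    (h : i = 0 ∨ i = n ∨ ∃ c, i = c + 1 ∧ p c) :
    ∑ j ∈ Finset.range i, s j =
      ∑ j ∈ Finset.range i, levelMean (Nat.count p) s n (Nat.count p j) := by
  have key : ∀ m, (∀ j < n, Nat.count p j < m ↔ j < i) → ∑ j ∈ Finset.range i, s j =
      ∑ j ∈ Finset.range i, levelMean (Nat.count p) s n (Nat.count p j) := by
    intro m hm
    have h1 : Finset.filter (fun j => Nat.count p j < m) (Finset.range n) = Finset.range i := by
      ext j
      simp only [Finset.mem_filter, Finset.mem_range]
      constructor
      · rintro ⟨h1, h2⟩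
        exact (hm j h1).1 h2
      · intro h1
        exact ⟨by omega, (hm j (by omega)).2 h1⟩
    have := sum_levels_lt_eq (Nat.count p) s n m
    rwa [h1] at this
  rcases h with rfl | rfl | ⟨c, rfl, hc⟩
  · simp
  -- Any bound above all the counts works here; a count at `j` is at most `j`.
  · refine key (i + 1) fun j hj => ⟨fun _ => hj, fun _ => ?_⟩
    have := Nat.count_le (p := p) (n := j)
    omega
  · refine key (Nat.count p (c + 1)) fun j _ => ⟨fun h => ?_, fun h => ?_⟩
    · by_contra! h2
      exact absurd (Nat.count_monotone p h2) (by omega)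
    · have h2 := Nat.count_monotone p (Nat.lt_succ_iff.1 h)
      rw [Nat.count_succ_eq_succ_count hc]
      omega

variable {p s n}

theorem LevelChain.antitone (h : LevelChain p s n) {i j : ℕ} (hij : i ≤ j) (hj : j < n) :
    levelMean (Nat.count p) s n (Nat.count p j) ≤ levelMean (Nat.count p) s n (Nat.count p i) := by
  have hm := Nat.count_monotone p hij
  have hn := Nat.count_monotone p (show j ≤ n - 1 by omega)
  obtain ⟨d, hd⟩ := Nat.exists_eq_add_of_le hm
  rw [hd] at hn ⊢
  clear hd hm
  induction d with
  | zero => exact le_rfl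
  | succ d ih => exact (h (Nat.count p i + d) (by omega)).le.trans (ih (by omega))

/-- A concave function which vanishes at both ends is nonnegative. -/
theorem sum_range_nonneg_of_antitone {g : ℕ → ℝ} (hg : ∀ i j, i ≤ j → j < n → g j ≤ g i)
    (h0 : ∑ j ∈ Finset.range n, g j = 0) {i : ℕ} (hi : i ≤ n) :
    0 ≤ ∑ j ∈ Finset.range i, g j := by
  rcases hi.eq_or_lt with rfl | hi'
  · exact h0.ge
  -- Either all terms before `i` are nonnegative, or all terms from `i` on are negative while the
  -- total is zero.
  rcases le_or_gt 0 (g i) with h | h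
  · exact Finset.sum_nonneg fun j hj => h.trans (hg j i (Finset.mem_range.1 hj).le hi')
  · have h1 := Finset.sum_range_add_sum_Ico g hi
    have h2 : ∑ j ∈ Finset.Ico i n, g j ≤ 0 := Finset.sum_nonpos fun j hj =>
      (hg i j (Finset.mem_Ico.1 hj).1 (Finset.mem_Ico.1 hj).2).trans h.le
    linarith

/-- Points marked by `p` lie on the upper polygon. Any other point lies on the lower one, and upper
minus lower is concave and zero at both ends. -/
theorem LevelChain.sum_range_le (h : LevelChain p s n)
    (h' : LevelChain (fun c => ¬ p c) (fun j => -s j) n) {i : ℕ} (hi : i ≤ n) :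
    ∑ j ∈ Finset.range i, s j ≤
      ∑ j ∈ Finset.range i, levelMean (Nat.count p) s n (Nat.count p j) := by
  by_cases hc : i = 0 ∨ i = n ∨ ∃ c, i = c + 1 ∧ p c
  · exact (sum_range_eq_sum_levelMean p s n hi hc).le
  · have hc' : i = 0 ∨ i = n ∨ ∃ c, i = c + 1 ∧ ¬ p c := by
      push Not at hc
      obtain ⟨c, rfl⟩ := Nat.exists_eq_succ_of_ne_zero hc.1
      exact Or.inr (Or.inr ⟨c, rfl, hc.2.2 c rfl⟩)
    have e1 := sum_range_eq_sum_levelMean (fun c => ¬ p c) (fun j => -s j) n hi hc'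
    have e2 := sum_range_eq_sum_levelMean (fun c => ¬ p c) (fun j => -s j) n le_rfl (by simp)
    have e3 := sum_range_eq_sum_levelMean p s n le_rfl (by simp)
    -- The second summand is minus the slope of the lower polygon, since its level means are those
    -- of `-s`.
    have e4 := sum_range_nonneg_of_antitone (n := n)
      (g := fun j => levelMean (Nat.count p) s n (Nat.count p j) +
        levelMean (Nat.count fun c => ¬ p c) (fun j => -s j) n (Nat.count (fun c => ¬ p c) j))
      (fun i j hij hj => add_le_add (h.antitone hij hj) (h'.antitone hij hj))
      (by rw [Finset.sum_add_distrib, ← e2, ← e3]; simp) hi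
    rw [Finset.sum_add_distrib, ← e1, Finset.sum_neg_distrib] at e4
    linarith

/-- The graph meets the concave upper polygon at `c + 1` and is below it at `a` and `b`. So the mean
of `s` on the left is at least the polygon's slope `A c`, the mean on the right at most `A (c + 1)`,
and the polygon has a strict corner between them. -/
theorem LevelChain.aboveChords (h : LevelChain p s n)
    (h' : LevelChain (fun c => ¬ p c) (fun j => -s j) n) : AboveChords p s n := by
  intro a c b hac hcb hbn hc
  set A : ℕ → ℝ := fun j => levelMean (Nat.count p) s n (Nat.count p j) with hA
  have ea := h.sum_range_le h' (show a ≤ n by omega)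
  have eb := h.sum_range_le h' hbn
  have ec := sum_range_eq_sum_levelMean p s n (show c + 1 ≤ n by omega)
    (Or.inr (Or.inr ⟨c, rfl, hc⟩))
  have hlt : A (c + 1) < A c := by
    simp only [hA]
    rw [Nat.count_succ_eq_succ_count hc]
    refine h _ ?_
    have := Nat.count_monotone p (show c + 1 ≤ n - 1 by omega)
    rw [Nat.count_succ_eq_succ_count hc] at this
    omega
  have s1 := Finset.sum_range_add_sum_Ico s (show a ≤ c + 1 by omega)
  have s2 := Finset.sum_range_add_sum_Ico s hcb.le
  have s3 := Finset.sum_range_add_sum_Ico A (show a ≤ c + 1 by omega)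
  have s4 := Finset.sum_range_add_sum_Ico A hcb.le
  have l1 : ((c : ℝ) + 1 - a) * A c ≤ ∑ j ∈ Finset.Ico a (c + 1), A j := by
    have := Finset.card_nsmul_le_sum (Finset.Ico a (c + 1)) A (A c) fun j hj =>
      h.antitone (Nat.lt_succ_iff.1 (Finset.mem_Ico.1 hj).2) (by omega)
    rw [Nat.card_Ico, nsmul_eq_mul, Nat.cast_sub (by omega)] at this
    push_cast at this
    exact this
  have l2 : ∑ j ∈ Finset.Ico (c + 1) b, A j ≤ ((b : ℝ) - (c + 1)) * A (c + 1) := by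
    have := Finset.sum_le_card_nsmul (Finset.Ico (c + 1) b) A (A (c + 1)) fun j hj =>
      h.antitone (Finset.mem_Ico.1 hj).1 (lt_of_lt_of_le (Finset.mem_Ico.1 hj).2 hbn)
    rw [Nat.card_Ico, nsmul_eq_mul, Nat.cast_sub (by omega)] at this
    push_cast at this
    exact this
  have hx : (0 : ℝ) < c + 1 - a := by
    have : (a : ℝ) ≤ c := by exact_mod_cast hac
    linarith
  have hy : (0 : ℝ) < b - (c + 1) := by
    have : ((c + 1 : ℕ) : ℝ) < b := by exact_mod_cast hcb
    push_cast at this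
    linarith
  have m1 : ((c : ℝ) + 1 - a) * A c ≤ ∑ j ∈ Finset.Ico a (c + 1), s j := by linarith
  have m2 : ∑ j ∈ Finset.Ico (c + 1) b, s j ≤ ((b : ℝ) - (c + 1)) * A (c + 1) := by linarith
  exact mul_lt_mul_of_mean_lt hx hy m1 m2 hlt

theorem levelMean_eq_of_filter {f : ℕ → ℕ} {k a b : ℕ}
    (h : ∀ j, j < n ∧ f j = k ↔ a ≤ j ∧ j < b) :
    levelMean f s n k = (∑ j ∈ Finset.Ico a b, s j) / ((b - a : ℕ) : ℝ) := by
  have : Finset.filter (fun j => f j = k) (Finset.range n) = Finset.Ico a b := by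
    ext j
    simp [h]
  rw [levelMean, this, Nat.card_Ico]

/-- Two successive levels are cut out by three points `a < c + 1 < b`, the middle one marked by `p`;
the chain inequality is the chord condition for these. -/
theorem AboveChords.levelChain (h : AboveChords p s n) : LevelChain p s n := by
  intro k hk
  set f := Nat.count p with hf
  have hmono : Monotone f := Nat.count_monotone p
  have hstep : ∀ i, f (i + 1) ≤ f i + 1 := fun i => by
    rw [hf, Nat.count_succ]
    split_ifs <;> omega
  have hstep' : ∀ i, f i < f (i + 1) → p i := fun i hi => by
    by_contra hp
    rw [hf, Nat.count_succ_eq_count hp] at hi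
    omega
  -- Level `k` will be `[a, c + 1)` and level `k + 1` will be `[c + 1, b)`. The alternative `i = n`
  -- in `ex3` serves the case that `k + 1` is the last level.
  have ex1 : ∃ i, k ≤ f i := ⟨n - 1, hk.le⟩
  have ex2 : ∃ i, k < f (i + 1) := ⟨n - 1, hk.trans_le (hmono (by omega))⟩
  have ex3 : ∃ i, k + 1 < f i ∨ i = n := ⟨n, Or.inr rfl⟩
  obtain ⟨a, ha, ha'⟩ : ∃ a, k ≤ f a ∧ ∀ i < a, f i < k :=
    ⟨Nat.find ex1, Nat.find_spec ex1, fun i hi => not_le.1 (Nat.find_min ex1 hi)⟩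
  obtain ⟨c, hc, hc'⟩ : ∃ c, k < f (c + 1) ∧ ∀ i < c, f (i + 1) ≤ k :=
    ⟨Nat.find ex2, Nat.find_spec ex2, fun i hi => not_lt.1 (Nat.find_min ex2 hi)⟩
  obtain ⟨b, hb, hb'⟩ : ∃ b, (k + 1 < f b ∨ b = n) ∧ ∀ i < b, f i ≤ k + 1 ∧ i ≠ n :=
    ⟨Nat.find ex3, Nat.find_spec ex3, fun i hi => by
      have := Nat.find_min ex3 hi
      push Not at this
      exact this⟩
  have hfc : f c ≤ k := by
    rcases Nat.eq_zero_or_pos c with rfl | h0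
    · simp [hf]
    · have := hc' (c - 1) (by omega)
      rwa [Nat.sub_add_cancel h0] at this
  have hpc := hstep' c (by omega)
  have hfc1 := hstep c
  have hac : a ≤ c := by
    by_contra! hlt
    have := ha' c hlt
    omega
  have hcn : c + 1 < n := by
    by_contra! hlt
    have := hmono (show n - 1 ≤ c by omega)
    omega
  have hcb : c + 1 < b := by
    by_contra! hlt
    have := hmono hlt
    omega
  have hbn : b ≤ n := by
    by_contra! hlt
    exact (hb' n hlt).2 rfl
  have l1 : ∀ j, j < n ∧ f j = k ↔ a ≤ j ∧ j < c + 1 := by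
    intro j
    constructor
    · rintro ⟨-, h2⟩
      constructor
      · by_contra! hlt
        have := ha' j hlt
        omega
      · by_contra! hlt
        have := hmono hlt
        omega
    · rintro ⟨h1, h2⟩
      have i1 := hmono h1
      have i2 := hmono (show j ≤ c by omega)
      omega
  have l2 : ∀ j, j < n ∧ f j = k + 1 ↔ c + 1 ≤ j ∧ j < b := by
    intro j
    constructor
    · rintro ⟨h1, h2⟩
      constructor
      · by_contra! hlt
        have := hmono (show j ≤ c by omega)
        omega
      · by_contra! hlt
        have := hmono hlt
        omega
    · rintro ⟨h1, h2⟩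
      have i1 := hmono h1
      have i2 := (hb' j h2).1
      omega
  have key := h a c b hac hcb hbn hpc
  rw [levelMean_eq_of_filter l1, levelMean_eq_of_filter l2, Nat.cast_sub hcb.le,
    Nat.cast_sub (by omega)]
  have hx : (0 : ℝ) < ((c + 1 : ℕ) : ℝ) - a := sub_pos.2 (by exact_mod_cast Nat.lt_succ_iff.2 hac)
  have hy : (0 : ℝ) < b - ((c + 1 : ℕ) : ℝ) := sub_pos.2 (by exact_mod_cast hcb)
  rw [div_lt_div_iff₀ hy hx]
  push_cast
  exact key

/-- If `x` increases along the arrows between neighbours then the sum of `x` times the deviation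
of `s` from its mean over the interval is not positive. -/
theorem sum_mul_sub_mean_nonpos {a b : ℕ} (hab : a < b) {μ : ℝ}
    (hμ : ∑ j ∈ Finset.Ico a b, s j = μ * (b - a))
    (h1 : ∀ c, a ≤ c → c + 1 < b → p c → (∑ j ∈ Finset.Ico (c + 1) b, s j) * (c + 1 - a) <
      (∑ j ∈ Finset.Ico a (c + 1), s j) * (b - (c + 1)))
    (h2 : ∀ c, a ≤ c → c + 1 < b → ¬ p c → (∑ j ∈ Finset.Ico a (c + 1), s j) * (b - (c + 1)) <
      (∑ j ∈ Finset.Ico (c + 1) b, s j) * (c + 1 - a))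
    {x : ℕ → ℝ} (hx1 : ∀ c, a ≤ c → c + 1 < b → p c → x c ≤ x (c + 1))
    (hx2 : ∀ c, a ≤ c → c + 1 < b → ¬ p c → x (c + 1) ≤ x c) :
    ∑ j ∈ Finset.Ico a b, (s j - μ) * x j ≤ 0 := by
  have hba : (0 : ℝ) < b - a := sub_pos.2 (by exact_mod_cast hab)
  -- Summation by parts, one term at a time: every weight so far is replaced by the latest one. At
  -- `m = b` the bracket is zero because `μ` is the mean.
  have key : ∀ m, a + 1 ≤ m → m ≤ b → ∑ j ∈ Finset.Ico a m, (s j - μ) * x j ≤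
      (∑ j ∈ Finset.Ico a m, s j - μ * (m - a)) * x (m - 1) := by
    intro m hm
    induction m, hm using Nat.le_induction with
    | base =>
      intro _
      simp
    | succ m hm ih =>
      intro hmb
      have ih := ih (by omega)
      obtain ⟨c, rfl⟩ : ∃ c, m = c + 1 := ⟨m - 1, by omega⟩
      rw [Finset.sum_Ico_succ_top (show a ≤ c + 1 by omega),
        Finset.sum_Ico_succ_top (show a ≤ c + 1 by omega)]
      simp only [Nat.add_sub_cancel] at ih ⊢
      have hs := Finset.sum_Ico_consecutive s (show a ≤ c + 1 by omega) (show c + 1 ≤ b by omega)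
      rw [hμ] at hs
      -- The first factor is the height of the point at `c + 1` over the chord, positive exactly
      -- when `p c` holds; the second has the opposite weak sign because `x` increases along arrows.
      have hprod : (∑ j ∈ Finset.Ico a (c + 1), s j - μ * ((c + 1 : ℕ) - a)) * (x c - x (c + 1))
          ≤ 0 := by
        push_cast
        by_cases hp : p c
        · have i1 := h1 c (by omega) (by omega) hp
          have i2 := hx1 c (by omega) (by omega) hp
          refine mul_nonpos_of_nonneg_of_nonpos ?_ (by linarith)
          by_contra! hneg
          nlinarith
        · have i1 := h2 c (by omega) (by omega) hp
          have i2 := hx2 c (by omega) (by omega) hp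
          refine mul_nonpos_of_nonpos_of_nonneg ?_ (by linarith)
          by_contra! hneg
          nlinarith
      push_cast at ih hprod ⊢
      linarith
  have := key b (by omega) le_rfl
  rw [hμ, sub_self, zero_mul] at this
  exact this

end

/-! ### Indices, edges and stable intervals of the type A quiver -/

namespace TypeA

open QuiverRep QuiverRep.Subrep

variable {ℓ : ℕ} {τ : Fin ℓ → Bool}

/-- The index of a vertex. -/
def idx (x : TypeA τ) : ℕ := Fin.val (n := ℓ + 1) x

theorem idx_lt (x : TypeA τ) : idx x < ℓ + 1 := Fin.isLt (n := ℓ + 1) x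

theorem idx_le_idx {x y : TypeA τ} : idx x ≤ idx y ↔ x ≤ y := Iff.rfl

theorem idx_lt_idx {x y : TypeA τ} : idx x < idx y ↔ x < y := Iff.rfl

theorem idx_injective {x y : TypeA τ} (h : idx x = idx y) : x = y := Fin.ext h

/-- The vertex of a given index. -/
def ofIdx (τ : Fin ℓ → Bool) (i : ℕ) (h : i < ℓ + 1) : TypeA τ := (⟨i, h⟩ : Fin (ℓ + 1))

theorem idx_ofIdx (i : ℕ) (h : i < ℓ + 1) : idx (ofIdx τ i h) = i := rfl

/-- The edge between the vertices of indices `c` and `c + 1` points to the right. -/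
def IsForward (τ : Fin ℓ → Bool) (c : ℕ) : Prop := ∃ h : c < ℓ, τ ⟨c, h⟩ = true

instance (τ : Fin ℓ → Bool) : DecidablePred (IsForward τ) := fun c => by
  unfold IsForward
  infer_instance

theorem arrow_cases {x y : TypeA τ} (e : x ⟶ y) :
    (idx y = idx x + 1 ∧ IsForward τ (idx x)) ∨ (idx x = idx y + 1 ∧ ¬ IsForward τ (idx y)) := by
  have h : ∀ {x y : Fin (ℓ + 1)}, Arrow τ x y →
      (y.val = x.val + 1 ∧ IsForward τ x) ∨ (x.val = y.val + 1 ∧ ¬ IsForward τ y) := by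
    intro x y e
    cases e with
    | forward i h => exact Or.inl ⟨rfl, i.2, h⟩
    | backward i h =>
      refine Or.inr ⟨rfl, ?_⟩
      rintro ⟨_, h'⟩
      exact absurd (h'.symm.trans h) (by simp)
  exact h e

theorem exists_forward {c : ℕ} (h : IsForward τ c) (h1 : c < ℓ + 1) (h2 : c + 1 < ℓ + 1) :
    Nonempty (ofIdx τ c h1 ⟶ ofIdx τ (c + 1) h2) :=
  ⟨Arrow.forward ⟨c, h.1⟩ h.2⟩

theorem exists_backward {c : ℕ} (h : ¬ IsForward τ c) (h1 : c < ℓ + 1) (h2 : c + 1 < ℓ + 1) :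
    Nonempty (ofIdx τ (c + 1) h2 ⟶ ofIdx τ c h1) :=
  ⟨Arrow.backward ⟨c, by omega⟩ (by
    rw [← Bool.not_eq_true]
    exact fun h' => h ⟨_, h'⟩)⟩

theorem exists_arrow_of_forward {x y : TypeA τ} (hxy : idx y = idx x + 1)
    (h : IsForward τ (idx x)) : Nonempty (x ⟶ y) := by
  have hy : idx x + 1 < ℓ + 1 := hxy ▸ idx_lt y
  obtain rfl : y = ofIdx τ (idx x + 1) hy := idx_injective hxy
  exact exists_forward h (by omega) (by omega)

theorem exists_arrow_of_backward {x y : TypeA τ} (hxy : idx y = idx x + 1)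
    (h : ¬ IsForward τ (idx x)) : Nonempty (y ⟶ x) := by
  have hy : idx x + 1 < ℓ + 1 := hxy ▸ idx_lt y
  obtain rfl : y = ofIdx τ (idx x + 1) hy := idx_injective hxy
  exact exists_backward h (by omega) (by omega)

/-- A function on the vertices, extended by zero to a function of the index. -/
def extend (g : TypeA τ → ℝ) (i : ℕ) : ℝ := if h : i < ℓ + 1 then g (ofIdx τ i h) else 0

theorem extend_of_lt (g : TypeA τ → ℝ) {i : ℕ} (h : i < ℓ + 1) :
    extend g i = g (ofIdx τ i h) := dif_pos h

theorem extend_idx (g : TypeA τ → ℝ) (x : TypeA τ) : extend g (idx x) = g x := dif_pos (idx_lt x)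

theorem sum_eq_sum_range (g : TypeA τ → ℝ) :
    ∑ x, g x = ∑ j ∈ Finset.range (ℓ + 1), extend g j := by
  rw [Finset.sum_range]
  exact Finset.sum_congr rfl fun x _ => (extend_idx g x).symm

theorem sum_eq_sum_Ico (g : TypeA τ → ℝ) (a b : TypeA τ) (h : ∀ x, ¬(a ≤ x ∧ x ≤ b) → g x = 0) :
    ∑ x, g x = ∑ j ∈ Finset.Ico (idx a) (idx b + 1), extend g j := by
  rw [sum_eq_sum_range]
  symm
  refine Finset.sum_subset (fun j hj => ?_) (fun j hj hj' => ?_)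
  · have := idx_lt b
    rw [Finset.mem_Ico] at hj
    rw [Finset.mem_range]
    omega
  · rw [Finset.mem_range] at hj
    rw [Finset.mem_Ico] at hj'
    rw [extend_of_lt g hj]
    refine h _ fun hx => hj' ?_
    rw [← idx_le_idx, ← idx_le_idx, idx_ofIdx] at hx
    omega

/-- All the interval representations are stable along `α`, in terms of the partial sums of `α`. -/
def TotallyStable (α : TypeA τ → ℝ) : Prop :=
  AboveChords (IsForward τ) (extend α) (ℓ + 1) ∧
    AboveChords (fun c => ¬ IsForward τ c) (fun j => -extend α j) (ℓ + 1)

/-- The inequalities of `TotallyStable` for a single interval. -/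
def StableOn (α : TypeA τ → ℝ) (a b : TypeA τ) : Prop :=
  ∀ c, idx a ≤ c → c + 1 < idx b + 1 →
    (IsForward τ c → (∑ j ∈ Finset.Ico (c + 1) (idx b + 1), extend α j) * (c + 1 - idx a) <
      (∑ j ∈ Finset.Ico (idx a) (c + 1), extend α j) * (idx b + 1 - (c + 1))) ∧
    (¬ IsForward τ c → (∑ j ∈ Finset.Ico (idx a) (c + 1), extend α j) * (idx b + 1 - (c + 1)) <
      (∑ j ∈ Finset.Ico (c + 1) (idx b + 1), extend α j) * (c + 1 - idx a))

theorem totallyStable_iff (α : TypeA τ → ℝ) : TotallyStable α ↔ ∀ a b, StableOn α a b := by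
  constructor
  · rintro ⟨h1, h2⟩ a b c hac hcb
    have hb := idx_lt b
    refine ⟨fun hc => ?_, fun hc => ?_⟩
    · have := h1 _ c _ hac hcb (by omega) hc
      push_cast at this
      exact this
    · have := h2 _ c _ hac hcb (by omega) hc
      simp only [Finset.sum_neg_distrib, neg_mul, neg_lt_neg_iff] at this
      push_cast at this
      exact this
  · intro h
    constructor
    · intro a c b hac hcb hb hc
      -- A chord ending at the point `b` belongs to the interval whose last vertex is `b - 1`.
      have := (h (ofIdx τ a (by omega)) (ofIdx τ (b - 1) (by omega)) c hac
        (by rw [idx_ofIdx]; omega)).1 hc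
      rw [idx_ofIdx, idx_ofIdx, Nat.sub_add_cancel (by omega), Nat.cast_sub (by omega)] at this
      push_cast at this
      rwa [sub_add_cancel] at this
    · intro a c b hac hcb hb hc
      have := (h (ofIdx τ a (by omega)) (ofIdx τ (b - 1) (by omega)) c hac
        (by rw [idx_ofIdx]; omega)).2 hc
      rw [idx_ofIdx, idx_ofIdx, Nat.sub_add_cancel (by omega), Nat.cast_sub (by omega)] at this
      push_cast at this
      rw [sub_add_cancel] at this
      simpa only [Finset.sum_neg_distrib, neg_mul, neg_lt_neg_iff] using this

/-- The dimension vector of an interval representation. -/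
def ind (a b x : TypeA τ) : ℕ := if a ≤ x ∧ x ≤ b then 1 else 0

theorem ind_self_left {a b : TypeA τ} (h : a ≤ b) : ind a b a ≠ 0 := by simp [ind, h]

theorem ind_eq_one {a b x : TypeA τ} (h : a ≤ x ∧ x ≤ b) : ind a b x = 1 := if_pos h

theorem ind_eq_zero {a b x : TypeA τ} (h : ¬(a ≤ x ∧ x ≤ b)) : ind a b x = 0 := if_neg h

/-- The slope of an interval representation. -/
def meanOn (α : TypeA τ → ℝ) (a b : TypeA τ) : ℝ := slopeVec α (ind a b)

theorem sum_mul_ind (g : TypeA τ → ℝ) (a b : TypeA τ) :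
    ∑ x, g x * (ind a b x : ℝ) = ∑ j ∈ Finset.Ico (idx a) (idx b + 1), extend g j := by
  rw [sum_eq_sum_Ico _ a b fun x hx => by simp [ind, hx]]
  refine Finset.sum_congr rfl fun j hj => ?_
  have hb := idx_lt b
  rw [Finset.mem_Ico] at hj
  rw [extend_of_lt _ (by omega), extend_of_lt _ (by omega), ind_eq_one, Nat.cast_one, mul_one]
  rw [← idx_le_idx, ← idx_le_idx, idx_ofIdx]
  omega

theorem sum_ind {a b : TypeA τ} (hab : a ≤ b) : ∑ x, (ind a b x : ℝ) = idx b + 1 - idx a := by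
  have := sum_mul_ind (fun _ => 1) a b
  simp only [one_mul] at this
  rw [this]
  have hb := idx_lt b
  have h : ∀ j ∈ Finset.Ico (idx a) (idx b + 1), extend (τ := τ) (fun _ => 1) j = 1 := by
    intro j hj
    rw [Finset.mem_Ico] at hj
    exact extend_of_lt _ (by omega)
  have hab' := idx_le_idx.2 hab
  rw [Finset.sum_congr rfl h, Finset.sum_const, Nat.card_Ico, nsmul_eq_mul, mul_one,
    Nat.cast_sub (by omega)]
  push_cast
  rfl

theorem meanOn_eq_iff (α : TypeA τ → ℝ) {a b : TypeA τ} (hab : a ≤ b) (t : ℝ) :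
    meanOn α a b = t ↔
      ∑ j ∈ Finset.Ico (idx a) (idx b + 1), extend α j = t * (idx b + 1 - idx a) := by
  rw [meanOn, slopeVec_eq_iff α (ind_self_left hab), sum_sub_mul_eq, sum_mul_ind, sum_ind hab,
    sub_eq_zero]

theorem meanOn_lt_meanOn_iff (α : TypeA τ → ℝ) {a b c d : TypeA τ} (hab : a ≤ b) (hcd : c ≤ d) :
    meanOn α a b < meanOn α c d ↔
      (∑ j ∈ Finset.Ico (idx a) (idx b + 1), extend α j) * (idx d + 1 - idx c) <
      (∑ j ∈ Finset.Ico (idx c) (idx d + 1), extend α j) * (idx b + 1 - idx a) := by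
  rw [(meanOn_eq_iff α hab _).1 rfl, (meanOn_eq_iff α hcd _).1 rfl]
  have h1 := sum_pos_of_ne_zero (ind_self_left hab)
  have h2 := sum_pos_of_ne_zero (ind_self_left hcd)
  rw [sum_ind hab] at h1
  rw [sum_ind hcd] at h2
  rw [mul_right_comm (meanOn α a b), mul_assoc, mul_assoc (meanOn α c d), mul_comm
    ((idx d : ℝ) + 1 - idx c)]
  exact (mul_lt_mul_iff_left₀ (mul_pos h1 h2)).symm

/-- A subquotient whose dimension vector is that of an interval, and whose maps are injective
along the interval, is semistable if `α` is stable on the interval. -/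
theorem semistableBetween_of_stableOn {K : Type u} [Field K] {V : QuiverRep K (TypeA τ)}
    {α : TypeA τ → ℝ} {a b : TypeA τ} (hab : a ≤ b) (hα : StableOn α a b) {A B : Subrep V}
    (hd : ∀ x, ind a b x + Module.finrank K (A.carrier x) = Module.finrank K (B.carrier x))
    (hinj : ∀ x y (e : x ⟶ y), (a ≤ x ∧ x ≤ b) → (a ≤ y ∧ y ≤ b) →
      ∀ v ∈ B.carrier x, V.map e v ∈ A.carrier y → v ∈ A.carrier x) :
    SemistableBetween α (meanOn α a b) A B := by
  constructor
  · rw [← sub_eq_zero, charge_sub_charge α _ hd, ← slopeVec_eq_iff α (ind_self_left hab)]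
    rfl
  intro M hAM hMB
  have hA : ∀ x, Module.finrank K (A.carrier x) ≤ Module.finrank K (M.carrier x) :=
    fun x => Submodule.finrank_mono (hAM x)
  have hB : ∀ x, Module.finrank K (M.carrier x) ≤ Module.finrank K (B.carrier x) :=
    fun x => Submodule.finrank_mono (hMB x)
  set d : TypeA τ → ℕ :=
    fun x => Module.finrank K (M.carrier x) - Module.finrank K (A.carrier x) with hd'
  have hdM : ∀ x, d x + Module.finrank K (A.carrier x) = Module.finrank K (M.carrier x) :=
    fun x => Nat.sub_add_cancel (hA x)
  have hle : ∀ x, d x ≤ ind a b x := fun x => by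
    have := hB x
    have := hd x
    have := hdM x
    omega
  -- The dimension of `M / A` is 0 or 1 on the interval, and injectivity forces it to increase along
  -- arrows. It is therefore an admissible weight in `sum_mul_sub_mean_nonpos`.
  have harr : ∀ x y (e : x ⟶ y), (a ≤ x ∧ x ≤ b) → (a ≤ y ∧ y ≤ b) → d x ≤ d y := by
    intro x y e hx hy
    rcases Nat.eq_zero_or_pos (d y) with h0 | h0
    · have hAy : A.carrier y = M.carrier y :=
        Submodule.eq_of_le_of_finrank_eq (hAM y) (by have := hdM y; omega)
      have hMx : M.carrier x ≤ A.carrier x := fun v hv =>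
        hinj x y e hx hy v (hMB x hv) (hAy ▸ M.map_mem e v hv)
      have := Submodule.finrank_mono hMx
      have := hdM x
      omega
    · have := hle x
      rw [ind_eq_one hx] at this
      omega
  rw [← sub_nonpos, charge_sub_charge α _ hdM]
  rw [sum_eq_sum_Ico _ a b fun x hx => by
    have := hle x
    rw [ind_eq_zero hx] at this
    simp [Nat.le_zero.1 this]]
  have hab' := idx_le_idx.2 hab
  have hb := idx_lt b
  have key := sum_mul_sub_mean_nonpos (p := IsForward τ) (s := extend α)
    (show idx a < idx b + 1 by omega) (μ := meanOn α a b)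
    (by rw [(meanOn_eq_iff α hab _).1 rfl]; push_cast; rfl)
    (fun c h1 h2 hc => by have := (hα c h1 h2).1 hc; push_cast; exact this)
    (fun c h1 h2 hc => by have := (hα c h1 h2).2 hc; push_cast; exact this)
    (x := extend fun x => (d x : ℝ)) ?_ ?_
  · refine le_of_eq_of_le (Finset.sum_congr rfl fun j hj => ?_) key
    rw [Finset.mem_Ico] at hj
    rw [extend_of_lt _ (by omega), extend_of_lt _ (by omega), extend_of_lt _ (by omega)]
  · intro c h1 h2 hc
    obtain ⟨e⟩ := exists_forward hc (by omega) (by omega)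
    rw [extend_of_lt _ (by omega), extend_of_lt _ (by omega)]
    refine Nat.cast_le.2 (harr _ _ e ?_ ?_) <;>
    · rw [← idx_le_idx, ← idx_le_idx, idx_ofIdx]
      omega
  · intro c h1 h2 hc
    obtain ⟨e⟩ := exists_backward hc (by omega) (by omega)
    rw [extend_of_lt _ (by omega), extend_of_lt _ (by omega)]
    refine Nat.cast_le.2 (harr _ _ e ?_ ?_) <;>
    · rw [← idx_le_idx, ← idx_le_idx, idx_ofIdx]
      omega

/-! ### The chains of inequalities -/

theorem chi_eq_count (x : TypeA τ) : chi τ x = Nat.count (IsForward τ) (idx x) := by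
  have h : ∀ i : Fin (ℓ + 1), chi τ (vertex τ i) = Nat.count (IsForward τ) i.val := by
    intro i
    induction i using Fin.induction with
    | zero => simp [chi, vertex]
    | succ i ih =>
      have : chi τ (vertex τ i.succ) =
          if τ i = true then chi τ (vertex τ i.castSucc) + 1 else chi τ (vertex τ i.castSucc) :=
        Fin.induction_succ (motive := fun _ => ℕ) _ _ _
      rw [this, ih, Fin.val_succ, Nat.count_succ, Fin.val_castSucc]
      have hi : IsForward τ i.val ↔ τ i = true := ⟨fun h => h.2, fun h => ⟨i.2, h⟩⟩
      simp only [hi]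
      split_ifs <;> rfl
  exact h x

theorem eta_eq_count (x : TypeA τ) :
    eta τ x = Nat.count (fun c => ¬ IsForward τ c) (idx x) := by
  have h : ∀ i : Fin (ℓ + 1),
      eta τ (vertex τ i) = Nat.count (fun c => ¬ IsForward τ c) i.val := by
    intro i
    induction i using Fin.induction with
    | zero => simp [eta, vertex]
    | succ i ih =>
      have : eta τ (vertex τ i.succ) =
          if τ i = false then eta τ (vertex τ i.castSucc) + 1 else eta τ (vertex τ i.castSucc) :=
        Fin.induction_succ (motive := fun _ => ℕ) _ _ _
      rw [this, ih, Fin.val_succ, Nat.count_succ, Fin.val_castSucc]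
      have hi : ¬ IsForward τ i.val ↔ τ i = false := by
        rw [← Bool.not_eq_true]
        exact not_congr ⟨fun h => h.2, fun h => ⟨i.2, h⟩⟩
      simp only [hi]
      split_ifs <;> rfl
  exact h x

theorem dimVec_intervalModule (K : Type u) [Field K] (a b : TypeA τ) :
    (intervalModule K τ a b).dimVec = ind a b := by
  funext x
  change Module.finrank K (PLift (a ≤ x ∧ x ≤ b) → K) = _
  rw [Module.finrank_fintype_fun_eq_card, ind]
  split_ifs with h
  · exact Fintype.card_eq_one_iff.2 ⟨⟨h⟩, fun _ => rfl⟩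
  · exact Fintype.card_eq_zero_iff.2 ⟨fun h' => h h'.down⟩

theorem exists_count_eq (p : ℕ → Prop) [DecidablePred p] {n k : ℕ} (h : k ≤ Nat.count p n) :
    ∃ i ≤ n, Nat.count p i = k := by
  induction n with
  | zero => exact ⟨0, le_rfl, by simpa [eq_comm] using h⟩
  | succ n ih =>
    by_cases hk : k ≤ Nat.count p n
    · obtain ⟨i, hi, h'⟩ := ih hk
      exact ⟨i, by omega, h'⟩
    · refine ⟨n + 1, le_rfl, ?_⟩
      rw [Nat.count_succ] at h ⊢
      split_ifs at h ⊢ <;> omega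

theorem levelMin_le_and_le_levelMax_iff {f : TypeA τ → ℕ} (hf : Monotone f) {k : ℕ}
    (hk : ∃ x, f x = k) (x : TypeA τ) : levelMin f k ≤ x ∧ x ≤ levelMax f k ↔ f x = k := by
  obtain ⟨y, hy⟩ := hk
  have hne : (Finset.univ.filter fun x => f x = k).Nonempty := ⟨y, by simp [hy]⟩
  constructor
  · rintro ⟨h1, h2⟩
    obtain ⟨y₁, hy₁, h3⟩ := Finset.exists_mem_eq_inf _ hne (id : TypeA τ → TypeA τ)
    obtain ⟨y₂, hy₂, h4⟩ := Finset.exists_mem_eq_sup _ hne (id : TypeA τ → TypeA τ)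
    rw [levelMin, h3] at h1
    rw [levelMax, h4] at h2
    have i1 := hf h1
    have i2 := hf h2
    rw [id, (Finset.mem_filter.1 hy₁).2] at i1
    rw [id, (Finset.mem_filter.1 hy₂).2] at i2
    exact le_antisymm i2 i1
  · intro hx
    have hm : x ∈ Finset.univ.filter fun x => f x = k := by simp [hx]
    exact ⟨Finset.inf_le (f := id) hm, Finset.le_sup (f := id) hm⟩

/-- The predicate is left open so that forward and backward edges, hence both chains, are covered.
-/
theorem slope_levelModule (K : Type u) [Field K] (α : TypeA τ → ℝ) (p : ℕ → Prop)
    [DecidablePred p] {f : TypeA τ → ℕ} (hf : ∀ x, f x = Nat.count p (idx x)) {k : ℕ}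
    (hk : k ≤ Nat.count p ℓ) :
    slope α (levelModule K f k) = levelMean (Nat.count p) (extend α) (ℓ + 1) k := by
  -- Counts grow by at most one per step, so no level is skipped. On an empty level `levelMin` and
  -- `levelMax` would be the default values `⊤` and `⊥`.
  have hex : ∃ x, f x = k := by
    obtain ⟨i, hi, h⟩ := exists_count_eq p hk
    exact ⟨ofIdx τ i (by omega), by rw [hf, idx_ofIdx, h]⟩
  have hmono : Monotone f := fun x y hxy => by
    rw [hf, hf]
    exact Nat.count_monotone p hxy
  have hd : ∀ x, (ind (levelMin f k) (levelMax f k) x : ℝ) =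
      if Nat.count p (idx x) = k then 1 else 0 := by
    intro x
    rw [ind]
    simp only [levelMin_le_and_le_levelMax_iff hmono hex, hf]
    split_ifs <;> simp
  have hsum : ∀ g : TypeA τ → ℝ, ∑ x, g x * (ind (levelMin f k) (levelMax f k) x : ℝ) =
      ∑ j ∈ Finset.range (ℓ + 1) with Nat.count p j = k, extend g j := by
    intro g
    rw [sum_eq_sum_range, Finset.sum_filter]
    refine Finset.sum_congr rfl fun j hj => ?_
    rw [Finset.mem_range] at hj
    rw [extend_of_lt _ hj, extend_of_lt _ hj, hd, idx_ofIdx]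
    split_ifs <;> simp
  have h1 := hsum fun _ => 1
  simp only [one_mul] at h1
  have h2 : ∑ j ∈ Finset.range (ℓ + 1) with Nat.count p j = k, extend (τ := τ) (fun _ => 1) j =
      ∑ j ∈ Finset.range (ℓ + 1) with Nat.count p j = k, (1 : ℝ) :=
    Finset.sum_congr rfl fun j hj =>
      extend_of_lt _ (Finset.mem_range.1 (Finset.mem_filter.1 hj).1)
  rw [slope_eq_slopeVec, levelModule, dimVec_intervalModule, slopeVec, hsum, h1, h2, levelMean,
    Finset.sum_const, nsmul_eq_mul, mul_one]

theorem levelMean_neg (f : ℕ → ℕ) (s : ℕ → ℝ) (n k : ℕ) :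
    levelMean f (fun j => -s j) n k = -levelMean f s n k := by
  rw [levelMean, levelMean, Finset.sum_neg_distrib, neg_div]

theorem totallyStable_iff_slope (K : Type u) [Field K] (α : TypeA τ → ℝ) :
    TotallyStable α ↔
      (∀ k < chi τ (vertex τ (Fin.last ℓ)),
        slope α (levelModule K (chi τ) k) > slope α (levelModule K (chi τ) (k + 1))) ∧
      (∀ k < eta τ (vertex τ (Fin.last ℓ)),
        slope α (levelModule K (eta τ) k) < slope α (levelModule K (eta τ) (k + 1))) := by
  have h0 : TotallyStable α ↔ LevelChain (IsForward τ) (extend α) (ℓ + 1) ∧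
      LevelChain (fun c => ¬ IsForward τ c) (fun j => -extend α j) (ℓ + 1) := by
    constructor
    · rintro ⟨h1, h2⟩
      exact ⟨h1.levelChain, h2.levelChain⟩
    · rintro ⟨h1, h2⟩
      -- The second use swaps the roles of the two polygons; the chain it needs is the first one up
      -- to a double negation and a double sign.
      refine ⟨h1.aboveChords h2, h2.aboveChords ?_⟩
      simpa only [not_not, neg_neg] using h1
  rw [h0, chi_eq_count, eta_eq_count]
  refine and_congr (forall₂_congr fun k hk => ?_) (forall₂_congr fun k hk => ?_)
  · change k < Nat.count _ ℓ at hk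
    rw [slope_levelModule K α _ chi_eq_count hk.le, slope_levelModule K α _ chi_eq_count hk]
  · change k < Nat.count _ ℓ at hk
    rw [slope_levelModule K α _ eta_eq_count hk.le, slope_levelModule K α _ eta_eq_count hk,
      levelMean_neg, levelMean_neg, neg_lt_neg_iff]

end TypeA

/-! ### Completeness forces all intervals to be stable -/

namespace TypeA

open QuiverRep QuiverRep.Subrep

variable {ℓ : ℕ} {τ : Fin ℓ → Bool}

/-- The representation on the vector spaces of the interval module of `[a, b]` in which the arrow
from `x` to `y` acts by the scalar `w x y`. -/
def weightedInterval (K : Type u) [Field K] (a b : TypeA τ) (w : TypeA τ → TypeA τ → K) :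
    QuiverRep K (TypeA τ) where
  obj x := PLift (a ≤ x ∧ x ≤ b) → K
  map {x y} _ :=
    { toFun := fun f _ => if h : a ≤ x ∧ x ≤ b then w x y * f ⟨h⟩ else 0
      map_add' := fun f g => by
        funext _
        by_cases h : a ≤ x ∧ x ≤ b <;> simp [h, mul_add]
      map_smul' := fun c f => by
        funext _
        by_cases h : a ≤ x ∧ x ≤ b <;> simp [h, mul_left_comm] }

section

variable {K : Type u} [Field K] {a b : TypeA τ} {w : TypeA τ → TypeA τ → K}

theorem weightedInterval_map_apply {x y : TypeA τ} (e : x ⟶ y) (hx : a ≤ x ∧ x ≤ b)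
    (hy : a ≤ y ∧ y ≤ b) (f : (weightedInterval K a b w).obj x) :
    (weightedInterval K a b w).map e f ⟨hy⟩ = w x y * f ⟨hx⟩ := dif_pos hx

theorem eq_zero_of_weightedInterval_map_eq_zero {x y : TypeA τ} (e : x ⟶ y) (hx : a ≤ x ∧ x ≤ b)
    (hy : a ≤ y ∧ y ≤ b) (hw : w x y ≠ 0) {f : (weightedInterval K a b w).obj x}
    (hf : (weightedInterval K a b w).map e f = 0) : f = 0 := by
  have h := congrFun hf ⟨hy⟩
  rw [weightedInterval_map_apply e hx hy] at h
  funext i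
  exact (mul_eq_zero.1 h).resolve_left hw

theorem dimVec_weightedInterval : (weightedInterval K a b w).dimVec = ind a b :=
  dimVec_intervalModule K a b

open Classical in
/-- The subrepresentation of a weighted interval representation supported on `Y`. -/
def supportedOn (K : Type u) [Field K] (a b : TypeA τ) (w : TypeA τ → TypeA τ → K)
    {Y : TypeA τ → Prop} (hY : ∀ x y : TypeA τ, (x ⟶ y) → Y x → Y y) :
    Subrep (weightedInterval K a b w) where
  carrier x := if Y x then ⊤ else ⊥
  map_mem {x y} e v hv := by
    by_cases h : Y x
    · rw [if_pos (hY x y e h)]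
      exact Submodule.mem_top
    · rw [if_neg h, Submodule.mem_bot] at hv
      rw [hv, map_zero]
      exact zero_mem _

theorem supportedOn_of_pos {Y : TypeA τ → Prop} (hY : ∀ x y : TypeA τ, (x ⟶ y) → Y x → Y y)
    {x : TypeA τ} (h : Y x) : (supportedOn K a b w hY).carrier x = ⊤ := if_pos h

theorem supportedOn_of_neg {Y : TypeA τ → Prop} (hY : ∀ x y : TypeA τ, (x ⟶ y) → Y x → Y y)
    {x : TypeA τ} (h : ¬ Y x) : (supportedOn K a b w hY).carrier x = ⊥ := if_neg h

/-- The weights across the cut between `Y` and its complement are unrestricted and do not enter the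
type: stability of the two sides uses only the nonzero weights within each side. -/
theorem isHNType_weightedInterval {α : TypeA τ → ℝ} {Y : TypeA τ → Prop}
    (hY : ∀ x y : TypeA τ, (x ⟶ y) → Y x → Y y) {a₁ b₁ a₂ b₂ : TypeA τ} (h₁ : a₁ ≤ b₁)
    (h₂ : a₂ ≤ b₂) (hY₁ : ∀ x, (a ≤ x ∧ x ≤ b) ∧ Y x ↔ a₁ ≤ x ∧ x ≤ b₁)
    (hY₂ : ∀ x, (a ≤ x ∧ x ≤ b) ∧ ¬ Y x ↔ a₂ ≤ x ∧ x ≤ b₂)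
    (hw : ∀ x y, (Y x ↔ Y y) → w x y ≠ 0) (hs₁ : StableOn α a₁ b₁) (hs₂ : StableOn α a₂ b₂)
    (hm : meanOn α a₂ b₂ ≤ meanOn α a₁ b₁) :
    IsHNType α (weightedInterval K a b w)
      (if meanOn α a₂ b₂ < meanOn α a₁ b₁ then [ind a₁ b₁, ind a₂ b₂]
        else [ind a₁ b₁ + ind a₂ b₂]) := by
  set R := supportedOn K a b w hY with hR
  have hV : ∀ x, Module.finrank K ((weightedInterval K a b w).obj x) = ind a b x :=
    congrFun dimVec_weightedInterval
  have d₁ : ∀ x, Module.finrank K (R.carrier x) = ind a₁ b₁ x := by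
    intro x
    by_cases h : a₁ ≤ x ∧ x ≤ b₁
    · have h' := (hY₁ x).2 h
      rw [ind_eq_one h, hR, supportedOn_of_pos hY h'.2, finrank_top, hV, ind_eq_one h'.1]
    · rw [ind_eq_zero h, hR]
      by_cases hy : Y x
      · rw [supportedOn_of_pos hY hy, finrank_top, hV,
          ind_eq_zero fun h' => h ((hY₁ x).1 ⟨h', hy⟩)]
      · rw [supportedOn_of_neg hY hy, finrank_bot]
  have d₂ : ∀ x, ind a b x = ind a₁ b₁ x + ind a₂ b₂ x := by
    intro x
    have i1 := hY₁ x
    have i2 := hY₂ x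
    unfold ind
    split_ifs <;> first | rfl | tauto
  have lt₁ : ⊥ < R := by
    refine lt_of_le_of_ne (fun x => bot_le) fun h => ind_self_left h₁ ?_
    rw [← d₁, ← h, bot_carrier, finrank_bot]
  have lt₂ : R < ⊤ := by
    refine lt_of_le_of_ne (fun x => le_top) fun h => ind_self_left h₂ ?_
    have i1 := d₁ a₂
    have i2 := d₂ a₂
    rw [h, top_carrier, finrank_top, hV] at i1
    omega
  refine isHNType_of_two_step lt₁ lt₂ (semistableBetween_of_stableOn h₁ hs₁ ?_ ?_)
    (semistableBetween_of_stableOn h₂ hs₂ ?_ ?_) hm d₁ ?_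
  · intro x
    rw [bot_carrier, finrank_bot, d₁, add_zero]
  · intro x y e hx hy v _ hv
    have hx' := (hY₁ x).2 hx
    have hy' := (hY₁ y).2 hy
    exact eq_zero_of_weightedInterval_map_eq_zero e hx'.1 hy'.1
      (hw x y (iff_of_true hx'.2 hy'.2)) hv
  · intro x
    rw [top_carrier, finrank_top, d₁, hV, d₂, add_comm]
  · intro x y e hx hy v _ hv
    have hx' := (hY₂ x).2 hx
    have hy' := (hY₂ y).2 hy
    rw [hR, supportedOn_of_neg hY hy'.2] at hv
    rw [eq_zero_of_weightedInterval_map_eq_zero e hx'.1 hy'.1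
      (hw x y (iff_of_false hx'.2 hy'.2)) hv]
    exact zero_mem _
  · intro x
    rw [dimVec_weightedInterval, d₂]

-- If the subrepresentation had slope at least that of the quotient, two choices of weights would
-- share a type: all weights 1, and weight 0 across the cut. An isomorphism between them is
-- impossible, since the arrow `e` across the cut is injective in the first and zero in the second.
open Classical in
theorem meanOn_lt_of_isCompleteCharge {α : TypeA τ → ℝ} (hα : IsCompleteCharge K α)
    {Y : TypeA τ → Prop} (hY : ∀ x y : TypeA τ, (x ⟶ y) → Y x → Y y) {a₁ b₁ a₂ b₂ : TypeA τ}
    (h₁ : a₁ ≤ b₁) (h₂ : a₂ ≤ b₂) (hY₁ : ∀ x, (a ≤ x ∧ x ≤ b) ∧ Y x ↔ a₁ ≤ x ∧ x ≤ b₁)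
    (hY₂ : ∀ x, (a ≤ x ∧ x ≤ b) ∧ ¬ Y x ↔ a₂ ≤ x ∧ x ≤ b₂)
    (hs₁ : StableOn α a₁ b₁) (hs₂ : StableOn α a₂ b₂) {x y : TypeA τ} (e : x ⟶ y)
    (hx : a₂ ≤ x ∧ x ≤ b₂) (hy : a₁ ≤ y ∧ y ≤ b₁) :
    meanOn α a₁ b₁ < meanOn α a₂ b₂ := by
  by_contra! hm
  obtain ⟨φ, hφ⟩ := hα _ _ ⟨_,
    isHNType_weightedInterval (a := a) (b := b) (w := fun _ _ => (1 : K)) hY h₁ h₂ hY₁ hY₂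
      (fun _ _ _ => one_ne_zero) hs₁ hs₂ hm,
    isHNType_weightedInterval (a := a) (b := b)
      (w := fun x y => if Y x ↔ Y y then (1 : K) else 0) hY h₁ h₂ hY₁ hY₂
      (fun x y h => by simp [h]) hs₁ hs₂ hm⟩
  have hx' := (hY₂ x).2 hx
  have hy' := (hY₁ y).2 hy
  have h := hφ x y e (fun _ => 1)
  have h0 : ∀ v, (weightedInterval K a b
      (fun x y => if Y x ↔ Y y then (1 : K) else 0)).map e v = 0 := by
    intro v
    funext i
    rw [weightedInterval_map_apply e hx'.1]
    simp only [hx'.2, hy'.2, iff_true, if_false, zero_mul]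
    rfl
  rw [h0, LinearEquiv.map_eq_zero_iff] at h
  have := eq_zero_of_weightedInterval_map_eq_zero e hx'.1 hy'.1 one_ne_zero h
  exact one_ne_zero (congrFun this ⟨hx'.1⟩)

end

/-- Induction on the length of the interval: both sides of a cut are shorter, hence stable, as the
comparison of their slopes requires. -/
theorem totallyStable_of_isCompleteCharge {K : Type u} [Field K] {α : TypeA τ → ℝ}
    (hα : IsCompleteCharge K α) : TotallyStable α := by
  rw [totallyStable_iff]
  have key : ∀ N (a b : TypeA τ), idx b - idx a = N → StableOn α a b := by
    intro N
    induction N using Nat.strong_induction_on with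
    | _ N ih =>
      intro a b hN c hac hcb
      have hb := idx_lt b
      set y : TypeA τ := ofIdx τ c (by omega) with hy
      set z : TypeA τ := ofIdx τ (c + 1) (by omega) with hz
      have iy : idx y = c := rfl
      have iz : idx z = c + 1 := rfl
      have hay : a ≤ y := idx_le_idx.1 hac
      have hzb : z ≤ b := idx_le_idx.1 (by omega)
      have s₁ : StableOn α a y := ih _ (by omega) a y rfl
      have s₂ : StableOn α z b := ih _ (by omega) z b rfl
      have mem₁ : ∀ x, (a ≤ x ∧ x ≤ b) ∧ idx x ≤ c ↔ a ≤ x ∧ x ≤ y := by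
        intro x
        rw [← idx_le_idx, ← idx_le_idx, ← idx_le_idx, iy]
        omega
      have mem₂ : ∀ x, (a ≤ x ∧ x ≤ b) ∧ c < idx x ↔ z ≤ x ∧ x ≤ b := by
        intro x
        rw [← idx_le_idx, ← idx_le_idx, ← idx_le_idx, iz]
        omega
      refine ⟨fun hc => ?_, fun hc => ?_⟩
      -- For a forward edge the right side is closed under the arrows of the interval and is the
      -- subrepresentation; for a backward edge it is the left side.
      · obtain ⟨e⟩ := exists_forward hc (by omega) (by omega)
        have := meanOn_lt_of_isCompleteCharge hα (Y := fun x => c < idx x) (fun x y e hx => by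
            rcases arrow_cases e with ⟨h, -⟩ | ⟨h, h'⟩
            · omega
            · by_contra! hlt
              obtain rfl : idx y = c := by omega
              exact h' hc) hzb hay mem₂ (by simpa only [not_lt] using mem₁) s₂ s₁ e
          ⟨hay, le_rfl⟩ ⟨le_rfl, hzb⟩
        rw [meanOn_lt_meanOn_iff α hzb hay, iy, iz] at this
        push_cast at this
        exact this
      · obtain ⟨e⟩ := exists_backward hc (by omega) (by omega)
        have := meanOn_lt_of_isCompleteCharge hα (Y := fun x => idx x ≤ c) (fun x y e hx => by
            rcases arrow_cases e with ⟨h, h'⟩ | ⟨h, -⟩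
            · by_contra! hlt
              obtain rfl : idx x = c := by omega
              exact hc h'
            · omega) hay hzb mem₁ (by simpa only [not_le] using mem₂) s₁ s₂ e
          ⟨le_rfl, hzb⟩ ⟨hay, le_rfl⟩
        rw [meanOn_lt_meanOn_iff α hay hzb, iy, iz] at this
        push_cast at this
        exact this
  exact fun a b => key _ a b rfl

end TypeA

/-! ### Decomposition into interval representations -/

section

variable {K : Type u} [Field K] {E F : Type*} [AddCommGroup E] [Module K E] [AddCommGroup F]
  [Module K F]

/-- The functional `φ` vanishes on the kernel of `E → F / Z`, and the functionals which do so are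
those pulled back along that map. -/
theorem exists_dual_comp_eq (f : E →ₗ[K] F) (Z : Submodule K F) (φ : E →ₗ[K] K)
    (h : ∀ v, f v ∈ Z → φ v = 0) : ∃ ψ : F →ₗ[K] K, (∀ z ∈ Z, ψ z = 0) ∧ ψ ∘ₗ f = φ := by
  have h1 : φ ∈ LinearMap.range (Z.mkQ ∘ₗ f).dualMap := by
    rw [LinearMap.range_dualMap_eq_dualAnnihilator_ker, Submodule.mem_dualAnnihilator]
    intro v hv
    refine h v ?_
    rwa [LinearMap.mem_ker, LinearMap.comp_apply, Submodule.mkQ_apply,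
      Submodule.Quotient.mk_eq_zero] at hv
  obtain ⟨ψ, hψ⟩ := h1
  refine ⟨ψ ∘ₗ Z.mkQ, fun z hz => ?_, hψ⟩
  rw [LinearMap.comp_apply, Submodule.mkQ_apply, (Submodule.Quotient.mk_eq_zero Z).2 hz, map_zero]

theorem exists_dual_eq_one (Z : Submodule K F) {v : F} (hv : v ∉ Z) :
    ∃ ψ : F →ₗ[K] K, (∀ z ∈ Z, ψ z = 0) ∧ ψ v = 1 := by
  obtain ⟨ψ, h1, h2⟩ := exists_dual_comp_eq (LinearMap.toSpanSingleton K F v) Z LinearMap.id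
    (fun t ht => by
      by_contra h0
      exact hv ((Z.smul_mem_iff h0).1 ht))
  refine ⟨ψ, h1, ?_⟩
  have := LinearMap.congr_fun h2 1
  simpa using this

end

namespace TypeA

open QuiverRep QuiverRep.Subrep

variable {ℓ : ℕ} {τ : Fin ℓ → Bool}

/-- This lets any arrow between two neighbours be replaced by a chosen one. The inner claim keeps
the end points free, at the price of `HEq`, so that case analysis on both arrows is possible. -/
instance (x y : TypeA τ) : Subsingleton (x ⟶ y) := by
  have h : ∀ {x y : Fin (ℓ + 1)} (e : Arrow τ x y) {x' y' : Fin (ℓ + 1)} (e' : Arrow τ x' y'),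
      x = x' → y = y' → HEq e e' := by
    intro x y e x' y' e' hx hy
    cases e with
    | forward i h =>
      cases e' with
      | forward j h' =>
        obtain rfl : i = j := Fin.castSucc_injective _ hx
        rfl
      | backward j h' =>
        have i1 := congrArg Fin.val hx
        have i2 := congrArg Fin.val hy
        simp only [Fin.val_castSucc, Fin.val_succ] at i1 i2
        omega
    | backward i h =>
      cases e' with
      | forward j h' =>
        have i1 := congrArg Fin.val hx
        have i2 := congrArg Fin.val hy
        simp only [Fin.val_castSucc, Fin.val_succ] at i1 i2
        omega
      | backward j h' =>
        obtain rfl : i = j := Fin.castSucc_injective _ hy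
        rfl
  exact ⟨fun e e' => eq_of_heq (h e e' rfl rfl)⟩

variable {K : Type u} [Field K]

/-- Compatible families of vectors and functionals which split off the interval representation
of `[a, m]` from the restriction of `V` to the vertices of index at most `m`. -/
structure PartialSummand (V : QuiverRep K (TypeA τ)) (m : ℕ) (a : TypeA τ) (v : ∀ x, V.obj x)
    (φ : ∀ x, V.obj x →ₗ[K] K) : Prop where
  vec_eq_zero : ∀ x, x < a → v x = 0
  coord_eq_zero : ∀ x, x < a → φ x = 0
  coord_vec : ∀ x, a ≤ x → idx x ≤ m → φ x (v x) = 1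
  map_vec : ∀ x y (e : x ⟶ y), idx x ≤ m → idx y ≤ m → a ≤ x → V.map e (v x) = v y
  coord_map : ∀ x y (e : x ⟶ y), idx x ≤ m → idx y ≤ m → a ≤ y → φ y ∘ₗ V.map e = φ x

variable {V : QuiverRep K (TypeA τ)}

theorem PartialSummand.single {a : TypeA τ} {v : V.obj a} {φ : V.obj a →ₗ[K] K} (h : φ v = 1)
    (hv : ∀ y (e : a ⟶ y), y < a → V.map e v = 0)
    (hφ : ∀ x (e : x ⟶ a), x < a → φ ∘ₗ V.map e = 0) :
    PartialSummand V (idx a) a (Function.update (fun _ => 0) a v)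
      (Function.update (fun _ => 0) a φ) where
  vec_eq_zero x hx := Function.update_of_ne hx.ne _ _
  coord_eq_zero x hx := Function.update_of_ne hx.ne _ _
  coord_vec x h1 h2 := by
    obtain rfl : a = x := le_antisymm h1 h2
    rwa [Function.update_self, Function.update_self]
  map_vec x y e h1 h2 h3 := by
    obtain rfl : a = x := le_antisymm h3 h1
    have hne : y < a := by
      refine lt_of_le_of_ne h2 fun hya => ?_
      rcases arrow_cases e with ⟨h, -⟩ | ⟨h, -⟩ <;> rw [hya] at h <;> omega
    rw [Function.update_self, Function.update_of_ne hne.ne, hv y e hne]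
  coord_map x y e h1 h2 h3 := by
    obtain rfl : a = y := le_antisymm h3 h2
    have hne : x < a := by
      refine lt_of_le_of_ne h1 fun hya => ?_
      rcases arrow_cases e with ⟨h, -⟩ | ⟨h, -⟩ <;> rw [hya] at h <;> omega
    rw [Function.update_self, Function.update_of_ne hne.ne, hφ x e hne]

theorem PartialSummand.extend {a x₀ x₁ : TypeA τ} {v : ∀ x, V.obj x} {φ : ∀ x, V.obj x →ₗ[K] K}
    (h : PartialSummand V (idx x₀) a v φ) (ha : a ≤ x₀) (hx : idx x₁ = idx x₀ + 1)
    {w : V.obj x₁} {ψ : V.obj x₁ →ₗ[K] K} (hw : ψ w = 1)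
    (h₀ : ∀ e : x₀ ⟶ x₁, V.map e (v x₀) = w ∧ ψ ∘ₗ V.map e = φ x₀)
    (h₁ : ∀ e : x₁ ⟶ x₀, V.map e w = v x₀ ∧ φ x₀ ∘ₗ V.map e = ψ) :
    PartialSummand V (idx x₁) a (Function.update v x₁ w) (Function.update φ x₁ ψ) := by
  have ne_of_le : ∀ {x : TypeA τ}, idx x ≤ idx x₀ → x ≠ x₁ := by
    rintro x h rfl
    omega
  have hax : a < x₁ := idx_lt_idx.1 (by
    have := idx_le_idx.2 ha
    omega)
  have hle : ∀ {x : TypeA τ}, idx x ≤ idx x₁ → idx x ≤ idx x₀ ∨ x = x₁ := by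
    intro x hx'
    rcases Nat.lt_or_ge (idx x₀) (idx x) with h | h
    · exact Or.inr (idx_injective (by omega))
    · exact Or.inl h
  refine ⟨fun x hxa => ?_, fun x hxa => ?_, fun x hxa hxm => ?_, fun x y e hxm hym hxa => ?_,
    fun x y e hxm hym hya => ?_⟩
  · rw [Function.update_of_ne (hxa.trans hax).ne, h.vec_eq_zero x hxa]
  · rw [Function.update_of_ne (hxa.trans hax).ne, h.coord_eq_zero x hxa]
  · rcases hle hxm with hx' | rfl
    · rw [Function.update_of_ne (ne_of_le hx'), Function.update_of_ne (ne_of_le hx')]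
      exact h.coord_vec x hxa hx'
    · rwa [Function.update_self, Function.update_self]
  · rcases hle hxm with hx' | rfl <;> rcases hle hym with hy' | rfl
    · rw [Function.update_of_ne (ne_of_le hx'), Function.update_of_ne (ne_of_le hy')]
      exact h.map_vec x y e hx' hy' hxa
    · obtain rfl : x = x₀ := idx_injective (by rcases arrow_cases e with h | h <;> omega)
      rw [Function.update_of_ne (ne_of_le hx'), Function.update_self]
      exact (h₀ e).1
    · obtain rfl : y = x₀ := idx_injective (by rcases arrow_cases e with h | h <;> omega)
      rw [Function.update_of_ne (ne_of_le hy'), Function.update_self]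
      exact (h₁ e).1
    · rcases arrow_cases e with h | h <;> omega
  · rcases hle hxm with hx' | rfl <;> rcases hle hym with hy' | rfl
    · rw [Function.update_of_ne (ne_of_le hx'), Function.update_of_ne (ne_of_le hy')]
      exact h.coord_map x y e hx' hy' hya
    · obtain rfl : x = x₀ := idx_injective (by rcases arrow_cases e with h | h <;> omega)
      rw [Function.update_of_ne (ne_of_le hx'), Function.update_self]
      exact (h₀ e).2
    · obtain rfl : y = x₀ := idx_injective (by rcases arrow_cases e with h | h <;> omega)
      rw [Function.update_of_ne (ne_of_le hy'), Function.update_self]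
      exact (h₁ e).2
    · rcases arrow_cases e with h | h <;> omega

/-- The pair `Z < R` records what the summand must respect at its right end, and is carried
leftwards: by preimage along a forward arrow, by image along a backward one. While the pair stays
strict, a summand found on the left extends; where it collapses, the interval begins. -/
theorem exists_partialSummand (V : QuiverRep K (TypeA τ)) (m : ℕ) :
    ∀ (x₁ : TypeA τ), idx x₁ = m → ∀ Z R : Submodule K (V.obj x₁), Z < R →
      ∃ (a : TypeA τ) (v : ∀ x, V.obj x) (φ : ∀ x, V.obj x →ₗ[K] K),
        PartialSummand V (idx x₁) a v φ ∧ a ≤ x₁ ∧ v x₁ ∈ R ∧ ∀ z ∈ Z, φ x₁ z = 0 := by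
  induction m with
  | zero =>
    intro x₁ h1 Z R hZR
    obtain ⟨v, hv, hvZ⟩ := SetLike.exists_of_lt hZR
    obtain ⟨φ, hφ, hφv⟩ := exists_dual_eq_one Z hvZ
    refine ⟨x₁, _, _, PartialSummand.single hφv (fun y _ hy => ?_) (fun y _ hy => ?_), le_rfl,
      by rwa [Function.update_self], by rwa [Function.update_self]⟩
    all_goals
      have := idx_lt_idx.2 hy
      omega
  | succ m ih =>
    intro x₁ h1 Z R hZR
    have hlt := idx_lt x₁
    obtain ⟨x₀, rfl⟩ : ∃ x₀ : TypeA τ, idx x₀ = m := ⟨ofIdx τ m (by omega), rfl⟩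
    by_cases hm : IsForward τ (idx x₀)
    · obtain ⟨e⟩ := exists_arrow_of_forward h1 hm
      have hback : (x₁ ⟶ x₀) → False := fun e' => by
        rcases arrow_cases e' with ⟨h, -⟩ | ⟨-, h⟩
        · omega
        · exact h hm
      -- On collapse, the modular law gives a vector of `R` outside `Z ⊔ range`. A functional that
      -- is 1 on it and kills `Z ⊔ range` composes to zero with the incoming arrow, so the interval
      -- can start at `x₁`.
      by_cases hc : R.comap (V.map e) ≤ Z.comap (V.map e)
      · have hR : ¬ R ≤ Z ⊔ LinearMap.range (V.map e) := by
          intro hR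
          refine hZR.not_ge ?_
          have h2 := sup_inf_assoc_of_le (LinearMap.range (V.map e)) hZR.le
          rw [inf_eq_right.2 hR] at h2
          rw [h2]
          refine sup_le le_rfl ?_
          rintro _ ⟨⟨v, rfl⟩, hv⟩
          exact hc hv
        obtain ⟨v, hv, hvZ⟩ := SetLike.not_le_iff_exists.1 hR
        obtain ⟨φ, hφ, hφv⟩ := exists_dual_eq_one _ hvZ
        refine ⟨x₁, _, _, PartialSummand.single hφv (fun y e' hy => ?_) (fun y e' hy => ?_),
          le_rfl, by rwa [Function.update_self], ?_⟩
        · obtain rfl : y = x₀ := idx_injective (by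
            have := idx_lt_idx.2 hy
            rcases arrow_cases e' with h | h <;> omega)
          exact (hback e').elim
        · obtain rfl : y = x₀ := idx_injective (by
            have := idx_lt_idx.2 hy
            rcases arrow_cases e' with h | h <;> omega)
          rw [Subsingleton.elim e' e]
          ext v
          exact hφ _ (Submodule.mem_sup_right ⟨v, rfl⟩)
        · rw [Function.update_self]
          exact fun z hz => hφ z (Submodule.mem_sup_left hz)
      · obtain ⟨a, v, φ, hS, ha, hv, hφ⟩ := ih x₀ rfl (Z.comap (V.map e)) (R.comap (V.map e))
          (lt_of_le_not_ge (Submodule.comap_mono hZR.le) hc)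
        obtain ⟨ψ, hψ, hψφ⟩ := exists_dual_comp_eq (V.map e) Z (φ x₀) hφ
        refine ⟨a, _, _, hS.extend ha h1 (w := V.map e (v x₀)) (ψ := ψ) ?_ ?_ ?_, ?_, ?_, ?_⟩
        · rw [← LinearMap.comp_apply, hψφ]
          exact hS.coord_vec x₀ ha le_rfl
        · intro e'
          rw [Subsingleton.elim e' e]
          exact ⟨rfl, hψφ⟩
        · exact fun e' => (hback e').elim
        · exact idx_le_idx.1 ((idx_le_idx.2 ha).trans (by omega))
        · rwa [Function.update_self]
        · rwa [Function.update_self]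
    · obtain ⟨e⟩ := exists_arrow_of_backward h1 hm
      have hback : (x₀ ⟶ x₁) → False := fun e' => by
        rcases arrow_cases e' with ⟨-, h⟩ | ⟨h, -⟩
        · exact hm h
        · omega
      -- Dually, on collapse the modular law gives a vector of `R` in the kernel of the outgoing
      -- arrow and outside `Z`.
      by_cases hc : R.map (V.map e) ≤ Z.map (V.map e)
      · have hR : ¬ LinearMap.ker (V.map e) ⊓ R ≤ Z := by
          intro hR
          refine hZR.not_ge ?_
          have h2 := sup_inf_assoc_of_le (LinearMap.ker (V.map e)) hZR.le
          rw [Submodule.map_le_iff_le_comap, Submodule.comap_map_eq] at hc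
          rw [inf_eq_right.2 hc] at h2
          rw [h2]
          exact sup_le le_rfl hR
        obtain ⟨v, hv, hvZ⟩ := SetLike.not_le_iff_exists.1 hR
        obtain ⟨φ, hφ, hφv⟩ := exists_dual_eq_one _ hvZ
        refine ⟨x₁, _, _, PartialSummand.single hφv (fun y e' hy => ?_) (fun y e' hy => ?_),
          le_rfl, by rw [Function.update_self]; exact hv.2, by rwa [Function.update_self]⟩
        · obtain rfl : y = x₀ := idx_injective (by
            have := idx_lt_idx.2 hy
            rcases arrow_cases e' with h | h <;> omega)
          rw [Subsingleton.elim e' e]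
          exact hv.1
        · obtain rfl : y = x₀ := idx_injective (by
            have := idx_lt_idx.2 hy
            rcases arrow_cases e' with h | h <;> omega)
          exact (hback e').elim
      · obtain ⟨a, v, φ, hS, ha, ⟨w, hw, hwv⟩, hφ⟩ := ih x₀ rfl (Z.map (V.map e))
          (R.map (V.map e)) (lt_of_le_not_ge (Submodule.map_mono hZR.le) hc)
        refine ⟨a, _, _, hS.extend ha h1 (w := w) (ψ := φ x₀ ∘ₗ V.map e) ?_ ?_ ?_, ?_, ?_, ?_⟩
        · rw [LinearMap.comp_apply, hwv]
          exact hS.coord_vec x₀ ha le_rfl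
        · exact fun e' => (hback e').elim
        · intro e'
          rw [Subsingleton.elim e' e]
          exact ⟨hwv, rfl⟩
        · exact idx_le_idx.1 ((idx_le_idx.2 ha).trans (by omega))
        · rwa [Function.update_self]
        · rw [Function.update_self]
          exact fun z hz => hφ _ ⟨z, hz, rfl⟩

/-- Compatible families of vectors and functionals which split off the interval representation
of `[a, b]`. -/
structure IsSummand (V : QuiverRep K (TypeA τ)) (a b : TypeA τ) (v : ∀ x, V.obj x)
    (φ : ∀ x, V.obj x →ₗ[K] K) : Prop where
  vec_eq_zero : ∀ x, ¬(a ≤ x ∧ x ≤ b) → v x = 0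
  coord_eq_zero : ∀ x, ¬(a ≤ x ∧ x ≤ b) → φ x = 0
  coord_vec : ∀ x, (a ≤ x ∧ x ≤ b) → φ x (v x) = 1
  map_vec : ∀ x y (e : x ⟶ y), (a ≤ x ∧ x ≤ b) → V.map e (v x) = v y
  coord_map : ∀ x y (e : x ⟶ y), (a ≤ y ∧ y ≤ b) → ∀ u, φ y (V.map e u) = φ x u

/-- Take for `b` the last vertex with a nonzero space, and the pair `⊥ < ⊤` there. Nothing survives
to the right of `b`, so the partial summand splits off from all of `V`. -/
theorem exists_isSummand (hV : V.IsNonzero) :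
    ∃ (a b : TypeA τ) (v : ∀ x, V.obj x) (φ : ∀ x, V.obj x →ₗ[K] K),
      a ≤ b ∧ IsSummand V a b v φ := by
  classical
  obtain ⟨x, hx⟩ := hV
  obtain ⟨b, hb, hmax⟩ := Finset.exists_max_image
    (Finset.univ.filter fun x => Nontrivial (V.obj x)) id ⟨x, by simpa using hx⟩
  have hbn : Nontrivial (V.obj b) := (Finset.mem_filter.1 hb).2
  have hsub : ∀ x, ¬ x ≤ b → Subsingleton (V.obj x) := fun x hx => by
    rw [← not_nontrivial_iff_subsingleton]
    exact fun h => hx (hmax x (by simpa using h))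
  obtain ⟨a, v, φ, hS, hab, -, -⟩ := exists_partialSummand V (idx b) b rfl ⊥ ⊤ bot_lt_top
  refine ⟨a, b, v, φ, hab, ⟨fun x hx => ?_, fun x hx => ?_, fun x hx => ?_, fun x y e hx => ?_,
    fun x y e hy u => ?_⟩⟩
  · by_cases hxb : x ≤ b
    · exact hS.vec_eq_zero x (by
        by_contra! h
        exact hx ⟨h, hxb⟩)
    · have := hsub x hxb
      exact Subsingleton.elim _ _
  · by_cases hxb : x ≤ b
    · exact hS.coord_eq_zero x (by
        by_contra! h
        exact hx ⟨h, hxb⟩)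
    · have := hsub x hxb
      ext u
      rw [Subsingleton.elim u 0, map_zero, map_zero]
  · exact hS.coord_vec x hx.1 hx.2
  · by_cases hyb : y ≤ b
    · exact hS.map_vec x y e hx.2 hyb hx.1
    · have := hsub y hyb
      exact Subsingleton.elim _ _
  · by_cases hxb : x ≤ b
    · exact LinearMap.congr_fun (hS.coord_map x y e hxb hy.2 hy.1) u
    · have := hsub x hxb
      rw [Subsingleton.elim u 0, map_zero, map_zero, map_zero]

/-- A decomposition of `V` into interval representations, indexed by `J`. -/
structure IntervalDecomp (V : QuiverRep K (TypeA τ)) (J : Type) [Fintype J] where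
  /-- the left end of an interval -/
  lo : J → TypeA τ
  /-- the right end of an interval -/
  hi : J → TypeA τ
  /-- the basis vectors -/
  vec : J → ∀ x, V.obj x
  /-- the coordinates -/
  coord : J → ∀ x, V.obj x →ₗ[K] K
  lo_le_hi : ∀ j, lo j ≤ hi j
  isSummand : ∀ j, IsSummand V (lo j) (hi j) (vec j) (coord j)
  coord_vec_of_ne : ∀ i j x, i ≠ j → coord i x (vec j x) = 0
  sum_coord : ∀ x v, ∑ j, coord j x v • vec j x = v

namespace IsSummand

variable {a b : TypeA τ} {v : ∀ x, V.obj x} {φ : ∀ x, V.obj x →ₗ[K] K}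

theorem coord_smul_vec (h : IsSummand V a b v φ) (x : TypeA τ) (u : V.obj x) :
    φ x (φ x u • v x) = φ x u := by
  by_cases hx : a ≤ x ∧ x ≤ b
  · rw [map_smul, h.coord_vec x hx, smul_eq_mul, mul_one]
  · rw [h.coord_eq_zero x hx]
    rfl

/-- The complement of a direct summand. -/
def compl (h : IsSummand V a b v φ) : Subrep V where
  carrier x := LinearMap.ker (φ x)
  map_mem {x y} e u hu := by
    by_cases hy : a ≤ y ∧ y ≤ b
    · rw [LinearMap.mem_ker, h.coord_map x y e hy]
      exact hu
    · rw [LinearMap.mem_ker, h.coord_eq_zero y hy]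
      rfl

/-- The projection to the complement of a direct summand. -/
def proj (h : IsSummand V a b v φ) (x : TypeA τ) : V.obj x →ₗ[K] h.compl.carrier x :=
  (LinearMap.id - (φ x).smulRight (v x)).codRestrict _ fun u => by
    change φ x (u - φ x u • v x) = 0
    rw [map_sub, h.coord_smul_vec, sub_self]

theorem coe_proj (h : IsSummand V a b v φ) (x : TypeA τ) (u : V.obj x) :
    (h.proj x u : V.obj x) = u - φ x u • v x := rfl

theorem proj_coe (h : IsSummand V a b v φ) (x : TypeA τ) (u : h.compl.carrier x) :
    h.proj x u = u := by
  apply Subtype.ext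
  rw [coe_proj, show φ x u = 0 from u.2, zero_smul, sub_zero]

theorem proj_vec (h : IsSummand V a b v φ) (x : TypeA τ) : h.proj x (v x) = 0 := by
  by_cases hx : a ≤ x ∧ x ≤ b
  · apply Subtype.ext
    rw [coe_proj, h.coord_vec x hx, one_smul, sub_self]
    rfl
  · rw [h.vec_eq_zero x hx, map_zero]

theorem proj_map (h : IsSummand V a b v φ) {x y : TypeA τ} (e : x ⟶ y) (u : V.obj x) :
    h.proj y (V.map e u) = h.compl.toRep.map e (h.proj x u) := by
  apply Subtype.ext
  change V.map e u - φ y (V.map e u) • v y = V.map e (u - φ x u • v x)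
  rw [map_sub, map_smul, sub_right_inj]
  by_cases hx : a ≤ x ∧ x ≤ b
  · rw [h.map_vec x y e hx]
    by_cases hy : a ≤ y ∧ y ≤ b
    · rw [h.coord_map x y e hy]
    · rw [h.vec_eq_zero y hy, smul_zero, smul_zero]
  · rw [h.coord_eq_zero x hx, LinearMap.zero_apply, zero_smul]
    by_cases hy : a ≤ y ∧ y ≤ b
    · rw [h.coord_map x y e hy, h.coord_eq_zero x hx, LinearMap.zero_apply, zero_smul]
    · rw [h.vec_eq_zero y hy, smul_zero]

/-- A decomposition of the complement of a direct summand yields one of the whole. -/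
def decomp (h : IsSummand V a b v φ) (hab : a ≤ b) {J : Type} [Fintype J]
    (D : IntervalDecomp h.compl.toRep J) : IntervalDecomp V (Option J) where
  lo j := j.elim a D.lo
  hi j := j.elim b D.hi
  vec j x := j.elim (v x) fun i => (D.vec i x : h.compl.carrier x).1
  coord j x := j.elim (φ x) fun i => (D.coord i x : h.compl.carrier x →ₗ[K] K) ∘ₗ h.proj x
  lo_le_hi j := by
    cases j with
    | none => exact hab
    | some i => exact D.lo_le_hi i
  isSummand j := by
    cases j with
    | none => exact h
    | some i =>
      have hi := D.isSummand i
      refine ⟨fun x hx => ?_, fun x hx => ?_, fun x hx => ?_, fun x y e hx => ?_,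
        fun x y e hy u => ?_⟩
      · exact congrArg Subtype.val (hi.vec_eq_zero x hx)
      · change (D.coord i x : h.compl.carrier x →ₗ[K] K) ∘ₗ h.proj x = 0
        rw [hi.coord_eq_zero x hx]
        rfl
      · refine Eq.trans (congrArg (D.coord i x) (h.proj_coe x (D.vec i x))) ?_
        exact hi.coord_vec x hx
      · exact congrArg Subtype.val (hi.map_vec x y e hx)
      · refine Eq.trans (congrArg (D.coord i y) (h.proj_map e u)) ?_
        exact hi.coord_map x y e hy _
  coord_vec_of_ne i j x hij := by
    cases i with
    | none =>
      cases j with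
      | none => exact absurd rfl hij
      | some j => exact (D.vec j x : h.compl.carrier x).2
    | some i =>
      cases j with
      | none => exact (congrArg (D.coord i x) (h.proj_vec x)).trans (map_zero _)
      | some j =>
        refine Eq.trans (congrArg (D.coord i x) (h.proj_coe x (D.vec j x))) ?_
        exact D.coord_vec_of_ne i j x fun hij' => hij (congrArg some hij')
  sum_coord x u := by
    rw [Fintype.sum_option]
    have h2 : ∑ i, D.coord i x (h.proj x u) • (D.vec i x : h.compl.carrier x).1 =
        u - φ x u • v x :=
      (map_sum (Submodule.subtype (h.compl.carrier x))
        (fun i => (D.coord i x (h.proj x u) • D.vec i x : h.compl.carrier x)) _).symm.trans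
        (congrArg (Submodule.subtype (h.compl.carrier x)) (D.sum_coord x (h.proj x u)))
    change φ x u • v x + ∑ i, D.coord i x (h.proj x u) • (D.vec i x : h.compl.carrier x).1 = u
    rw [h2, add_sub_cancel]

end IsSummand

/-- Every representation of a quiver of type `A` is a direct sum of interval representations. -/
theorem exists_intervalDecomp (V : QuiverRep K (TypeA τ)) :
    ∃ (J : Type) (_ : Fintype J), Nonempty (IntervalDecomp V J) := by
  induction hN : ∑ x, V.dimVec x using Nat.strong_induction_on generalizing V with
  | _ N ih =>
    by_cases hV : V.IsNonzero
    · obtain ⟨a, b, v, φ, hab, h⟩ := exists_isSummand hV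
      have hlt : ∑ x, h.compl.toRep.dimVec x < N := by
        rw [← hN]
        refine Finset.sum_lt_sum (fun x _ => Submodule.finrank_le _) ⟨a, Finset.mem_univ a, ?_⟩
        refine Submodule.finrank_lt fun htop => ?_
        have h1 : v a ∈ h.compl.carrier a := htop ▸ Submodule.mem_top
        have h2 := h.coord_vec a ⟨le_rfl, hab⟩
        rw [show φ a (v a) = 0 from h1] at h2
        exact zero_ne_one h2
      obtain ⟨J, _, ⟨D⟩⟩ := ih _ hlt h.compl.toRep rfl
      exact ⟨Option J, inferInstance, ⟨h.decomp hab D⟩⟩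
    · refine ⟨Empty, inferInstance, ⟨⟨Empty.elim, Empty.elim, fun j => j.elim, fun j => j.elim,
        fun j => j.elim, fun j => j.elim, fun j => j.elim, fun x v => ?_⟩⟩⟩
      have : Subsingleton (V.obj x) := by
        rw [← not_nontrivial_iff_subsingleton]
        exact fun hx => hV ⟨x, hx⟩
      exact Subsingleton.elim _ _

end TypeA

/-! ### The Harder-Narasimhan type determines the interval multiplicities -/

theorem exists_forall_fin_iff_lt {n : ℕ} {P : Fin n → Prop} (h : ∀ i j, i ≤ j → P j → P i) :
    ∃ k ≤ n, ∀ i : Fin n, P i ↔ i.val < k := by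
  classical
  have ex : ∃ k, k = n ∨ ∃ h : k < n, ¬ P ⟨k, h⟩ := ⟨n, Or.inl rfl⟩
  refine ⟨Nat.find ex, Nat.find_min' ex (Or.inl rfl), fun i => ⟨fun hi => ?_, fun hi => ?_⟩⟩
  · by_contra! hlt
    rcases Nat.find_spec ex with h' | ⟨h', h''⟩
    · omega
    · exact h'' (h _ i hlt hi)
  · have := Nat.find_min ex hi
    push Not at this
    exact this.2 i.2

namespace TypeA

open QuiverRep QuiverRep.Subrep

variable {ℓ : ℕ} {τ : Fin ℓ → Bool} {K : Type u} [Field K] {V W : QuiverRep K (TypeA τ)}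

namespace IsSummand

variable {a b : TypeA τ} {v : ∀ x, V.obj x} {φ : ∀ x, V.obj x →ₗ[K] K}

theorem map_smul_vec_mem (h : IsSummand V a b v φ) {x y : TypeA τ} (e : x ⟶ y) {u : V.obj x}
    (hu : u ∈ Submodule.span K {v x}) : V.map e u ∈ Submodule.span K {v y} := by
  obtain ⟨t, rfl⟩ := Submodule.mem_span_singleton.1 hu
  rw [map_smul]
  by_cases hx : a ≤ x ∧ x ≤ b
  · rw [h.map_vec x y e hx]
    exact Submodule.smul_mem _ _ (Submodule.mem_span_singleton_self _)
  · rw [h.vec_eq_zero x hx, map_zero, smul_zero]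
    exact zero_mem _

/-- The interval subrepresentation of a direct summand. -/
def line (h : IsSummand V a b v φ) : Subrep V where
  carrier x := Submodule.span K {v x}
  map_mem e _ hu := h.map_smul_vec_mem e hu

/-- A summand is seen here as a subrepresentation and in `semistableBetween_compl` as a quotient:
the two roles in which it is compared with the steps of an HN filtration. -/
theorem semistableBetween_line (h : IsSummand V a b v φ) (hab : a ≤ b) {α : TypeA τ → ℝ}
    (hα : StableOn α a b) : SemistableBetween α (meanOn α a b) ⊥ h.line := by
  refine semistableBetween_of_stableOn hab hα (fun x => ?_) fun x y e hx hy u hu hfu => ?_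
  · rw [bot_carrier, finrank_bot, add_zero]
    change _ = Module.finrank K (Submodule.span K {v x})
    by_cases hx : a ≤ x ∧ x ≤ b
    · rw [ind_eq_one hx, finrank_span_singleton]
      intro h0
      have := h.coord_vec x hx
      rw [h0, map_zero] at this
      exact zero_ne_one this
    · rw [ind_eq_zero hx, h.vec_eq_zero x hx, Submodule.span_zero_singleton, finrank_bot]
  · obtain ⟨t, rfl⟩ := Submodule.mem_span_singleton.1 hu
    rw [bot_carrier, Submodule.mem_bot, map_smul, h.map_vec x y e hx] at hfu
    have := congrArg (φ y) hfu
    rw [map_smul, h.coord_vec y hy, map_zero, smul_eq_mul, mul_one] at this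
    rw [this, zero_smul]
    exact zero_mem _

theorem semistableBetween_compl (h : IsSummand V a b v φ) (hab : a ≤ b) {α : TypeA τ → ℝ}
    (hα : StableOn α a b) : SemistableBetween α (meanOn α a b) h.compl ⊤ := by
  refine semistableBetween_of_stableOn hab hα (fun x => ?_) fun x y e hx hy u _ hfu => ?_
  · rw [top_carrier, finrank_top, ← LinearMap.finrank_range_add_finrank_ker (φ x)]
    change _ + Module.finrank K (LinearMap.ker (φ x)) = _
    congr 1
    by_cases hx : a ≤ x ∧ x ≤ b
    · have : LinearMap.range (φ x) = ⊤ := LinearMap.range_eq_top.2 fun t =>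
        ⟨t • v x, by rw [map_smul, h.coord_vec x hx, smul_eq_mul, mul_one]⟩
      rw [ind_eq_one hx, this, finrank_top, Module.finrank_self]
    · rw [ind_eq_zero hx, h.coord_eq_zero x hx, LinearMap.range_zero, finrank_bot]
  · exact (h.coord_map x y e hy u).symm.trans hfu

end IsSummand

namespace IntervalDecomp

variable {J : Type} [Fintype J]

/-- The slope of a summand. -/
def mean (D : IntervalDecomp V J) (α : TypeA τ → ℝ) (j : J) : ℝ := meanOn α (D.lo j) (D.hi j)

/-- The vertex `x` lies in the interval of the summand `j`. -/
def Mem (D : IntervalDecomp V J) (x : TypeA τ) (j : J) : Prop := D.lo j ≤ x ∧ x ≤ D.hi j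

theorem coord_sum_smul_vec (D : IntervalDecomp V J) (x : TypeA τ) (t : J → K) (j : J) :
    D.coord j x (∑ i, t i • D.vec i x) = t j * D.coord j x (D.vec j x) := by
  classical
  rw [map_sum, Finset.sum_eq_single j]
  · rw [map_smul, smul_eq_mul]
  · intro i _ hij
    rw [map_smul, D.coord_vec_of_ne j i x hij.symm, smul_zero]
  · simp

open Classical in
theorem finrank_eq_card (D : IntervalDecomp V J) {x : TypeA τ} {P : J → Prop}
    {M : Submodule K (V.obj x)} (h1 : ∀ j, P j → D.vec j x ∈ M)
    (h2 : ∀ j, ¬ P j → ∀ u ∈ M, D.coord j x u = 0) :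
    Module.finrank K M = Finset.card {j | P j ∧ D.Mem x j} := by
  have hspan : M = Submodule.span K
      (Set.range fun j : {j // P j ∧ D.Mem x j} => D.vec j x) := by
    apply le_antisymm
    · intro u hu
      rw [← D.sum_coord x u]
      refine Submodule.sum_mem _ fun j _ => ?_
      by_cases hj : P j
      · by_cases hx : D.Mem x j
        · exact Submodule.smul_mem _ _ (Submodule.subset_span ⟨⟨j, hj, hx⟩, rfl⟩)
        · rw [(D.isSummand j).vec_eq_zero x hx, smul_zero]
          exact zero_mem _
      · rw [h2 j hj u hu, zero_smul]
        exact zero_mem _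
    · rw [Submodule.span_le]
      rintro _ ⟨j, rfl⟩
      exact h1 j j.2.1
  have hli : LinearIndependent K fun j : {j // P j ∧ D.Mem x j} => D.vec j x := by
    rw [Fintype.linearIndependent_iff]
    intro g hg i
    have h3 := congrArg (D.coord i x) hg
    rw [map_zero, map_sum, Finset.sum_eq_single i] at h3
    · rwa [map_smul, (D.isSummand i).coord_vec x i.2.2, smul_eq_mul, mul_one] at h3
    · intro j _ hji
      rw [map_smul, D.coord_vec_of_ne i j x fun h => hji (Subtype.ext h.symm), smul_zero]
    · simp
  rw [hspan, finrank_span_eq_card hli, Fintype.card_subtype]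

open Classical in
/-- The Harder-Narasimhan type determines the number of the summands which have their slope in a
given upper set and contain a given vertex. -/
theorem sum_eq_card_of_isHNType (D : IntervalDecomp V J) {α : TypeA τ → ℝ}
    (hα : TotallyStable α) {T : List (TypeA τ → ℕ)} (hT : V.IsHNType α T) {U : Set ℝ}
    (hU : IsUpperSet U) (x : TypeA τ) :
    (T.map fun d => if slopeVec α d ∈ U then d x else 0).sum =
      Finset.card {j | D.mean α j ∈ U ∧ D.Mem x j} := by
  obtain ⟨n, F, hF, rfl⟩ := hT
  rw [totallyStable_iff] at hα
  set s : Fin n → ℝ := fun i => slope α ((F i.castSucc).subquotient (F i.succ)) with hs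
  have hlt : ∀ i : Fin n, F i.castSucc < F i.succ := fun i => hF.strictMono i.castSucc_lt_succ
  have hss : ∀ i : Fin n, SemistableBetween α (s i) (F i.castSucc) (F i.succ) := fun i =>
    (isSemistable_subquotient_iff α (hlt i)).1 (hF.semistable i)
  obtain ⟨k, hkn, hk⟩ := exists_forall_fin_iff_lt (P := fun i => s i ∈ U) fun i j hij hj =>
    hU (hF.slope_strictAnti.antitone hij) hj
  -- Telescoping of the dimensions along the filtration.
  have hsum : ∀ m (hm : m < n + 1), ∑ i : Fin n,
      (if i.val < m then dimVec ((F i.castSucc).subquotient (F i.succ)) x else 0) =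
        Module.finrank K ((F ⟨m, hm⟩).carrier x) := by
    intro m
    induction m with
    | zero =>
      intro hm
      have : F ⟨0, hm⟩ = ⊥ := hF.bot
      rw [this, bot_carrier, finrank_bot]
      simp
    | succ m ih =>
      intro hm
      have h1 := dimVec_subquotient (hlt ⟨m, by omega⟩).le x
      have h2 := ih (by omega)
      have h3 : ∀ i : Fin n,
          (if i.val < m + 1 then dimVec ((F i.castSucc).subquotient (F i.succ)) x else 0) =
          (if i.val < m then dimVec ((F i.castSucc).subquotient (F i.succ)) x else 0) +
          (if i = ⟨m, by omega⟩ then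
            dimVec ((F i.castSucc).subquotient (F i.succ)) x else 0) := by
        intro i
        have : i = ⟨m, by omega⟩ ↔ i.val = m := Fin.ext_iff
        simp only [this]
        split_ifs <;> omega
      rw [Finset.sum_congr rfl fun i _ => h3 i, Finset.sum_add_distrib, h2, Finset.sum_ite_eq',
        if_pos (Finset.mem_univ _), add_comm]
      exact h1
  -- The first `k` steps have slopes in `U`, larger than that of `j`, so they map to zero in the
  -- quotient given by `j`.
  have hcompl : ∀ j, D.mean α j ∉ U → ∀ m (hm : m < n + 1), m ≤ k →
      F ⟨m, hm⟩ ≤ (D.isSummand j).compl := by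
    intro j hj m
    induction m with
    | zero =>
      intro hm _
      have : F ⟨0, hm⟩ = ⊥ := hF.bot
      rw [this]
      exact fun x => bot_le
    | succ m ih =>
      intro hm hmk
      refine (hss ⟨m, by omega⟩).le_of_slope_lt
        ((D.isSummand j).semistableBetween_compl (D.lo_le_hi j) (hα _ _)) ?_ (hlt ⟨m, by omega⟩).le
        (ih _ (by omega)) (fun x => le_top) (fun x => le_top)
      by_contra! hle
      exact hj (hU hle ((hk ⟨m, by omega⟩).2 hmk))
  -- Descending induction from `F n = ⊤`, with `r = n - m`: the steps after the first `k` have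
  -- slopes outside `U`, smaller than that of `j`, so the line of `j` maps to zero in them. With
  -- `hcompl`, `F k` is the sum of the summands with slope in `U`.
  have hline : ∀ j, D.mean α j ∈ U → ∀ r m (hm : m < n + 1), m + r = n → k ≤ m →
      (D.isSummand j).line ≤ F ⟨m, hm⟩ := by
    intro j hj r
    induction r with
    | zero =>
      rintro m hm rfl _
      have : F ⟨m, hm⟩ = ⊤ := hF.top
      rw [this]
      exact fun x => le_top
    | succ r ih =>
      intro m hm hmr hkm
      refine ((D.isSummand j).semistableBetween_line (D.lo_le_hi j) (hα _ _)).le_of_slope_lt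
        (hss ⟨m, by omega⟩) ?_ (fun x => bot_le) (fun x => bot_le) (hlt ⟨m, by omega⟩).le
        (ih (m + 1) (by omega) (by omega) (by omega))
      by_contra! hle
      exact absurd ((hk ⟨m, by omega⟩).1 (hU hle hj)) (by simp; omega)
  have hfin := D.finrank_eq_card (x := x) (P := fun j => D.mean α j ∈ U)
    (M := (F ⟨k, by omega⟩).carrier x)
    (fun j hj => hline j hj (n - k) k (by omega) (by omega) le_rfl x
      (Submodule.mem_span_singleton_self _))
    (fun j hj u hu => hcompl j hj k (by omega) le_rfl x hu)
  rw [← hfin, ← hsum k (by omega), List.map_ofFn, List.sum_ofFn]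
  refine Finset.sum_congr rfl fun i _ => ?_
  have := hk i
  simp only [hs, slope_eq_slopeVec] at this
  simp only [Function.comp_apply, this]

-- The count for the single slope `μ` is the difference of the counts for the upper sets `Set.Ici μ`
-- and `Set.Ioi μ`.
open Classical in
theorem card_mean_eq_of_isHNType {J' : Type} [Fintype J'] (D : IntervalDecomp V J)
    (D' : IntervalDecomp W J') {α : TypeA τ → ℝ} (hα : TotallyStable α)
    {T : List (TypeA τ → ℕ)} (hV : V.IsHNType α T) (hW : W.IsHNType α T) (μ : ℝ) (x : TypeA τ) :
    Finset.card {j | D.mean α j = μ ∧ D.Mem x j} =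
      Finset.card {j | D'.mean α j = μ ∧ D'.Mem x j} := by
  have key : ∀ {V : QuiverRep K (TypeA τ)} {J : Type} [Fintype J] (D : IntervalDecomp V J)
      (U₁ U₂ : Set ℝ), (∀ t, t ∈ U₁ ↔ t ∈ U₂ ∨ t = μ) → μ ∉ U₂ →
      Finset.card {j | D.mean α j ∈ U₁ ∧ D.Mem x j} =
        Finset.card {j | D.mean α j ∈ U₂ ∧ D.Mem x j} +
        Finset.card {j | D.mean α j = μ ∧ D.Mem x j} := by
    intro V J _ D U₁ U₂ h₁ h₂
    rw [← Finset.card_union_of_disjoint]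
    · congr 1
      ext j
      simp only [Finset.mem_filter, Finset.mem_univ, true_and, Finset.mem_union, h₁]
      tauto
    · rw [Finset.disjoint_filter]
      rintro j _ ⟨h1, -⟩ ⟨h2, -⟩
      exact h₂ (h2 ▸ h1)
  have h1 := (D.sum_eq_card_of_isHNType hα hV (isUpperSet_Ici μ) x).symm.trans
    (D'.sum_eq_card_of_isHNType hα hW (isUpperSet_Ici μ) x)
  have h2 := (D.sum_eq_card_of_isHNType hα hV (isUpperSet_Ioi μ) x).symm.trans
    (D'.sum_eq_card_of_isHNType hα hW (isUpperSet_Ioi μ) x)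
  have h5 : ∀ t, t ∈ Set.Ici μ ↔ t ∈ Set.Ioi μ ∨ t = μ := fun t => by
    rw [Set.mem_Ici, Set.mem_Ioi, le_iff_lt_or_eq, eq_comm]
  have h3 := key D _ _ h5 Set.self_notMem_Ioi
  have h4 := key D' _ _ h5 Set.self_notMem_Ioi
  omega

end IntervalDecomp

/-- No three points of the graph of the partial sums are collinear. -/
theorem StableOn.false_of_mean_eq {α : TypeA τ → ℝ} {a b : TypeA τ} (h : StableOn α a b) {c : ℕ}
    (h1 : idx a ≤ c) (h2 : c < idx b) {μ : ℝ}
    (hl : ∑ j ∈ Finset.Ico (idx a) (c + 1), extend α j = μ * (c + 1 - idx a))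
    (hr : ∑ j ∈ Finset.Ico (c + 1) (idx b + 1), extend α j = μ * (idx b + 1 - (c + 1))) :
    False := by
  have h3 := h c h1 (by omega)
  rw [hl, hr] at h3
  by_cases hc : IsForward τ c
  · exact absurd (h3.1 hc) (by rw [mul_right_comm]; exact lt_irrefl _)
  · exact absurd (h3.2 hc) (by rw [mul_right_comm]; exact lt_irrefl _)

/-- Otherwise the points at `a`, `c + 1` and `b + 1` would be collinear. -/
theorem TotallyStable.hi_not_lt {α : TypeA τ → ℝ} (hα : TotallyStable α) {a b c : TypeA τ}
    (hac : a ≤ c) (h : meanOn α a c = meanOn α a b) : ¬ c < b := by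
  intro hcb
  have h1 := idx_le_idx.2 hac
  have h2 := idx_lt_idx.2 hcb
  have e1 := (meanOn_eq_iff α hac _).1 h
  have e2 := (meanOn_eq_iff α (hac.trans hcb.le) _).1 rfl
  refine ((totallyStable_iff α).1 hα a b).false_of_mean_eq h1 h2 e1 ?_
  have e3 := Finset.sum_Ico_consecutive (extend α) (show idx a ≤ idx c + 1 by omega)
    (show idx c + 1 ≤ idx b + 1 by omega)
  rw [e1, e2] at e3
  linarith

theorem TotallyStable.hi_eq {α : TypeA τ → ℝ} (hα : TotallyStable α) {a b c : TypeA τ}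
    (hab : a ≤ b) (hac : a ≤ c) (h : meanOn α a c = meanOn α a b) : c = b :=
  le_antisymm (not_lt.1 (hα.hi_not_lt hab h.symm)) (not_lt.1 (hα.hi_not_lt hac h))

/-- Otherwise the points at `a`, `b + 1 = c` and `d + 1` would be collinear. -/
theorem TotallyStable.not_adjacent {α : TypeA τ → ℝ} (hα : TotallyStable α) {a b c d : TypeA τ}
    (hab : a ≤ b) (hcd : c ≤ d) (hbc : idx c = idx b + 1) : meanOn α a b ≠ meanOn α c d := by
  intro h
  have e1 := (meanOn_eq_iff α hab _).1 h
  have e2 := (meanOn_eq_iff α hcd _).1 rfl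
  have h1 := idx_le_idx.2 hcd
  rw [hbc] at e2
  push_cast at e2
  exact ((totallyStable_iff α).1 hα a d).false_of_mean_eq (idx_le_idx.2 hab)
    (show idx b < idx d by omega) e1 e2

namespace IntervalDecomp

variable {J : Type} [Fintype J]

open Classical in
/-- The multiplicity of an interval, in terms of the number of the summands of its slope at its
left end and at the vertex to the left of that. -/
theorem card_mean_eq_add (D : IntervalDecomp V J) {α : TypeA τ → ℝ} (hα : TotallyStable α)
    {a b : TypeA τ} (hab : a ≤ b) :
    Finset.card {j | D.mean α j = meanOn α a b ∧ D.Mem a j} =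
      Finset.card {j | D.mean α j = meanOn α a b ∧ ∃ y, idx a = idx y + 1 ∧ D.Mem y j} +
      Finset.card {j | D.lo j = a ∧ D.hi j = b} := by
  rw [← Finset.card_union_of_disjoint]
  · congr 1
    ext j
    simp only [Finset.mem_filter, Finset.mem_univ, true_and, Finset.mem_union]
    constructor
    · rintro ⟨h1, h2, h3⟩
      -- A summand of this slope through `a` either also contains the vertex before `a`, or starts
      -- at `a` and then ends at `b`, the slope and left end fixing the right end.
      rcases h2.lt_or_eq with h | rfl
      · have h' := idx_lt_idx.2 h
        have ha := idx_lt a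
        refine Or.inl ⟨h1, ofIdx τ (idx a - 1) (by omega), ?_, ?_⟩
        · rw [idx_ofIdx]
          omega
        · have h3' := idx_le_idx.2 h3
          rw [Mem, ← idx_le_idx, ← idx_le_idx, idx_ofIdx]
          omega
      · exact Or.inr ⟨rfl, hα.hi_eq hab (D.lo_le_hi j) h1⟩
    · rintro (⟨h1, y, h2, h3, h4⟩ | ⟨rfl, rfl⟩)
      · have h3' := idx_le_idx.2 h3
        have h4' := idx_le_idx.2 h4
        refine ⟨h1, idx_le_idx.1 (by omega), ?_⟩
        -- A summand ending just before `a` would be adjacent to `[a, b]` and of the same slope.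
        by_contra! hlt
        have hlt' := idx_lt_idx.2 hlt
        exact hα.not_adjacent (D.lo_le_hi j) hab (by omega) h1
      · exact ⟨rfl, le_rfl, hab⟩
  · rw [Finset.disjoint_filter]
    rintro j _ ⟨-, y, h1, h2, -⟩ ⟨h4, -⟩
    have := idx_le_idx.2 h2
    rw [h4] at this
    omega

open Classical in
theorem card_eq_of_isHNType {J' : Type} [Fintype J'] (D : IntervalDecomp V J)
    (D' : IntervalDecomp W J') {α : TypeA τ → ℝ} (hα : TotallyStable α)
    {T : List (TypeA τ → ℕ)} (hV : V.IsHNType α T) (hW : W.IsHNType α T) (a b : TypeA τ) :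
    Finset.card {j | D.lo j = a ∧ D.hi j = b} = Finset.card {j | D'.lo j = a ∧ D'.hi j = b} := by
  by_cases hab : a ≤ b
  · have h1 := D.card_mean_eq_add hα hab
    have h2 := D'.card_mean_eq_add hα hab
    have h3 := D.card_mean_eq_of_isHNType D' hα hV hW (meanOn α a b) a
    have h4 : Finset.card
        {j | D.mean α j = meanOn α a b ∧ ∃ y, idx a = idx y + 1 ∧ D.Mem y j} = Finset.card
        {j | D'.mean α j = meanOn α a b ∧ ∃ y, idx a = idx y + 1 ∧ D'.Mem y j} := by
      -- The first vertex has no left neighbour; there both counts are zero.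
      by_cases hy : ∃ y : TypeA τ, idx a = idx y + 1
      · obtain ⟨y, hy⟩ := hy
        have h5 : ∀ P : TypeA τ → Prop, (∃ z, idx a = idx z + 1 ∧ P z) ↔ P y := fun P =>
          ⟨fun ⟨z, hz, h⟩ => (idx_injective (by omega) : z = y) ▸ h, fun h => ⟨y, hy, h⟩⟩
        simp only [h5]
        exact D.card_mean_eq_of_isHNType D' hα hV hW _ y
      · have h5 : ∀ P : TypeA τ → Prop, (∃ z, idx a = idx z + 1 ∧ P z) ↔ False := fun P =>
          ⟨fun ⟨z, hz, _⟩ => hy ⟨z, hz⟩, False.elim⟩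
        simp only [h5, and_false, Finset.filter_false, Finset.card_empty]
    omega
  · have h : ∀ {V : QuiverRep K (TypeA τ)} {J : Type} [Fintype J] (D : IntervalDecomp V J),
        Finset.card {j | D.lo j = a ∧ D.hi j = b} = 0 := by
      intro V J _ D
      rw [Finset.card_eq_zero, Finset.filter_eq_empty_iff]
      rintro j _ ⟨rfl, rfl⟩
      exact hab (D.lo_le_hi j)
    rw [h D, h D']

/-- A reindexing of a decomposition. -/
def reindex {J' : Type} [Fintype J'] (D : IntervalDecomp V J') (σ : J ≃ J') :
    IntervalDecomp V J where
  lo j := D.lo (σ j)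
  hi j := D.hi (σ j)
  vec j := D.vec (σ j)
  coord j := D.coord (σ j)
  lo_le_hi j := D.lo_le_hi (σ j)
  isSummand j := D.isSummand (σ j)
  coord_vec_of_ne i j x hij := D.coord_vec_of_ne _ _ x fun h => hij (σ.injective h)
  sum_coord x v := by
    rw [Equiv.sum_comp σ fun j => D.coord j x v • D.vec j x]
    exact D.sum_coord x v

/-- The map between two decomposed representations which maps basis vectors to basis vectors. -/
def transfer (D : IntervalDecomp V J) (D' : IntervalDecomp W J) (x : TypeA τ) :
    V.obj x →ₗ[K] W.obj x :=
  ∑ j, (D.coord j x).smulRight (D'.vec j x)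

theorem transfer_apply (D : IntervalDecomp V J) (D' : IntervalDecomp W J) (x : TypeA τ)
    (u : V.obj x) : D.transfer D' x u = ∑ j, D.coord j x u • D'.vec j x := by
  simp [transfer]

theorem transfer_transfer (D : IntervalDecomp V J) (D' : IntervalDecomp W J)
    (hlo : ∀ j, D.lo j = D'.lo j) (hhi : ∀ j, D.hi j = D'.hi j) (x : TypeA τ) (u : V.obj x) :
    D'.transfer D x (D.transfer D' x u) = u := by
  conv_rhs => rw [← D.sum_coord x u]
  rw [transfer_apply, transfer_apply]
  refine Finset.sum_congr rfl fun j _ => ?_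
  rw [D'.coord_sum_smul_vec]
  by_cases hx : D.lo j ≤ x ∧ x ≤ D.hi j
  · rw [(D'.isSummand j).coord_vec x (by rwa [← hlo, ← hhi]), mul_one]
  · rw [(D.isSummand j).vec_eq_zero x hx, smul_zero, smul_zero]

theorem transfer_map (D : IntervalDecomp V J) (D' : IntervalDecomp W J)
    (hlo : ∀ j, D.lo j = D'.lo j) (hhi : ∀ j, D.hi j = D'.hi j) {x y : TypeA τ} (e : x ⟶ y)
    (u : V.obj x) : D.transfer D' y (V.map e u) = W.map e (D.transfer D' x u) := by
  rw [transfer_apply, transfer_apply, map_sum]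
  refine Finset.sum_congr rfl fun j _ => ?_
  have hD := D.isSummand j
  have hD' := D'.isSummand j
  rw [← hlo, ← hhi] at hD'
  rw [map_smul]
  by_cases hy : D.lo j ≤ y ∧ y ≤ D.hi j
  · rw [hD.coord_map x y e hy]
    by_cases hx : D.lo j ≤ x ∧ x ≤ D.hi j
    · rw [hD'.map_vec x y e hx]
    · rw [hD.coord_eq_zero x hx, LinearMap.zero_apply, zero_smul, zero_smul]
  · rw [hD'.vec_eq_zero y hy, smul_zero]
    by_cases hx : D.lo j ≤ x ∧ x ≤ D.hi j
    · rw [hD'.map_vec x y e hx, hD'.vec_eq_zero y hy, smul_zero]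
    · rw [hD.coord_eq_zero x hx, LinearMap.zero_apply, zero_smul]

theorem isomorphic (D : IntervalDecomp V J) (D' : IntervalDecomp W J)
    (hlo : ∀ j, D.lo j = D'.lo j) (hhi : ∀ j, D.hi j = D'.hi j) : V.Isomorphic W :=
  ⟨fun x => LinearEquiv.ofLinearMap (D.transfer D' x) (D'.transfer D x)
    (LinearMap.ext fun u => D'.transfer_transfer D (fun j => (hlo j).symm)
      (fun j => (hhi j).symm) x u)
    (LinearMap.ext fun u => D.transfer_transfer D' hlo hhi x u),
    fun _ _ e u => D.transfer_map D' hlo hhi e u⟩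

end IntervalDecomp

theorem TotallyStable.isCompleteCharge {α : TypeA τ → ℝ} (hα : TotallyStable α) :
    IsCompleteCharge K α := by
  classical
  rintro V W ⟨T, hV, hW⟩
  obtain ⟨J, _, ⟨D⟩⟩ := exists_intervalDecomp V
  obtain ⟨J', _, ⟨D'⟩⟩ := exists_intervalDecomp W
  -- Equal multiplicities give bijections between the summands of each interval, which glue to one
  -- bijection of the index sets.
  have hcard : ∀ p : TypeA τ × TypeA τ, Nonempty
      ({j // (D.lo j, D.hi j) = p} ≃ {j // (D'.lo j, D'.hi j) = p}) := by
    rintro ⟨a, b⟩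
    refine ⟨Fintype.equivOfCardEq ?_⟩
    rw [Fintype.card_subtype, Fintype.card_subtype]
    simp only [Prod.mk.injEq]
    exact D.card_eq_of_isHNType D' hα hV hW a b
  let E := fun p => (hcard p).some
  have hσ := fun j => Equiv.ofFiberEquiv_map (f := fun j => (D.lo j, D.hi j))
    (g := fun j => (D'.lo j, D'.hi j)) E j
  exact D.isomorphic (D'.reindex (Equiv.ofFiberEquiv E))
    (fun j => (congrArg Prod.fst (hσ j)).symm) (fun j => (congrArg Prod.snd (hσ j)).symm)

end TypeA

/-! ### Existence of complete charges and the equioriented case -/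

/-- Points on two opposite parabolas are in convex position. -/
theorem aboveChords_of_le_parabola {p : ℕ → Prop} {S s : ℕ → ℝ} {n : ℕ}
    (hS : ∀ i ≤ n, S i ≤ i * (n - i))
    (hp : ∀ c, p c → S (c + 1) = ((c + 1 : ℕ) : ℝ) * (n - (c + 1 : ℕ)))
    (hs : ∀ j < n, s j = S (j + 1) - S j) : AboveChords p s n := by
  intro a c b hac hcb hbn hc
  have hsum : ∀ a b, a ≤ b → b ≤ n → ∑ j ∈ Finset.Ico a b, s j = S b - S a := by
    intro a b hab hbn
    rw [← Finset.sum_Ico_sub S hab]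
    exact Finset.sum_congr rfl fun j hj => hs j ((Finset.mem_Ico.1 hj).2.trans_le hbn)
  rw [hsum a (c + 1) (by omega) (by omega), hsum (c + 1) b hcb.le hbn, hp c hc]
  have ha := hS a (by omega)
  have hb := hS b hbn
  have h1 : (0 : ℝ) < c + 1 - a := by
    have : (a : ℝ) ≤ c := by exact_mod_cast hac
    linarith
  have h2 : (0 : ℝ) < b - (c + 1) := by
    have : ((c + 1 : ℕ) : ℝ) < b := by exact_mod_cast hcb
    push_cast at this
    linarith
  have h3 := mul_le_mul_of_nonneg_right hb h1.le
  have h4 := mul_le_mul_of_nonneg_right ha h2.le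
  -- This product is the height of the parabola over its own chord at `c + 1`, multiplied by the
  -- length `b - a`.
  have h5 : (0 : ℝ) < (c + 1 - a) * (b - (c + 1)) * ((c + 1 - a) + (b - (c + 1))) := by positivity
  push_cast
  linarith

namespace TypeA

variable {ℓ : ℕ}

theorem exists_totallyStable (τ : Fin ℓ → Bool) : ∃ α : TypeA τ → ℝ, TotallyStable α := by
  -- The point `i` belongs to the edge `i - 1`. The end points `0` and `ℓ + 1` have no edge, but
  -- there both parabolas vanish and the choice does not matter.
  set S : ℕ → ℝ := fun i =>
    if IsForward τ (i - 1) then (i : ℝ) * ((ℓ + 1 : ℕ) - i) else -((i : ℝ) * ((ℓ + 1 : ℕ) - i))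
    with hS
  have hnn : ∀ i ≤ ℓ + 1, (0 : ℝ) ≤ (i : ℝ) * ((ℓ + 1 : ℕ) - i) := fun i hi =>
    mul_nonneg (Nat.cast_nonneg i) (sub_nonneg.2 (Nat.cast_le.2 hi))
  have hext : ∀ j < ℓ + 1, extend (τ := τ) (fun x => S (idx x + 1) - S (idx x)) j =
      S (j + 1) - S j := fun j hj => extend_of_lt _ hj
  refine ⟨fun x => S (idx x + 1) - S (idx x), ?_, ?_⟩
  · refine aboveChords_of_le_parabola (S := S) (fun i hi => ?_) (fun c hc => ?_) hext
    · have := hnn i hi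
      simp only [hS]
      split_ifs <;> linarith
    · simp only [hS, Nat.add_sub_cancel, if_pos hc]
  · refine aboveChords_of_le_parabola (S := fun i => -S i) (fun i hi => ?_) (fun c hc => ?_)
      fun j hj => ?_
    · have := hnn i hi
      simp only [hS]
      split_ifs <;> linarith
    · simp only [hS, Nat.add_sub_cancel, if_neg hc, neg_neg]
    · rw [hext j hj]
      ring

theorem totallyStable_iff_of_forall_forward {τ : Fin ℓ → Bool} (hτ : ∀ i, τ i = true)
    (α : TypeA τ → ℝ) :
    TotallyStable α ↔ ∀ i : Fin ℓ, α (vertex τ i.castSucc) > α (vertex τ i.succ) := by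
  constructor
  · rintro ⟨h, -⟩ i
    -- Stability of the interval of the two vertices joined by the edge `i` is the required
    -- inequality.
    have h1 := h i.val i.val (i.val + 2) le_rfl (by omega) (by omega) ⟨i.2, hτ i⟩
    rw [show i.val + 2 = i.val + 1 + 1 from rfl, Nat.Ico_succ_singleton, Nat.Ico_succ_singleton,
      Finset.sum_singleton, Finset.sum_singleton] at h1
    push_cast at h1
    have h2 : extend α (i.val + 1) < extend α i.val := by linarith
    rw [extend_of_lt _ (by omega), extend_of_lt _ (by omega)] at h2
    exact h2
  · intro h
    have hstep : ∀ j, j + 1 < ℓ + 1 → extend α (j + 1) < extend α j := by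
      intro j hj
      rw [extend_of_lt _ hj, extend_of_lt _ (by omega)]
      exact h ⟨j, by omega⟩
    have hanti : ∀ i j, i ≤ j → j < ℓ + 1 → extend α j ≤ extend α i := by
      intro i j hij
      induction j, hij using Nat.le_induction with
      | base => exact fun _ => le_rfl
      | succ j _ ih => exact fun hj => (hstep j hj).le.trans (ih (by omega))
    constructor
    · intro a c b hac hcb hbn _
      refine mul_lt_mul_of_mean_lt (A := extend α c) (B := extend α (c + 1)) ?_ ?_ ?_ ?_
        (hstep c (by omega))
      · have : (a : ℝ) ≤ c := by exact_mod_cast hac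
        linarith
      · have : ((c + 1 : ℕ) : ℝ) < b := by exact_mod_cast hcb
        push_cast at this
        linarith
      · have := Finset.card_nsmul_le_sum (Finset.Ico a (c + 1)) (extend α) (extend α c)
          fun j hj => hanti _ _ (Nat.lt_succ_iff.1 (Finset.mem_Ico.1 hj).2) (by omega)
        rw [Nat.card_Ico, nsmul_eq_mul, Nat.cast_sub (by omega)] at this
        push_cast at this
        exact this
      · have := Finset.sum_le_card_nsmul (Finset.Ico (c + 1) b) (extend α) (extend α (c + 1))
          fun j hj => hanti _ _ (Finset.mem_Ico.1 hj).1
            (lt_of_lt_of_le (Finset.mem_Ico.1 hj).2 hbn)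
        rw [Nat.card_Ico, nsmul_eq_mul, Nat.cast_sub (by omega)] at this
        push_cast at this
        exact this
    · intro a c b _ hcb hbn hc
      exact absurd ⟨by omega, hτ ⟨c, by omega⟩⟩ hc

theorem isCompleteCharge_iff (K : Type u) [Field K] {τ : Fin ℓ → Bool} (α : TypeA τ → ℝ) :
    IsCompleteCharge K α ↔ TotallyStable α :=
  ⟨totallyStable_of_isCompleteCharge, TotallyStable.isCompleteCharge⟩

end TypeA

end

theorem theorem4p4 (K : Type u) [Field K] (ℓ : ℕ) (τ : Fin ℓ → Bool) :
    -- there is a complete central charge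
    (∃ α : TypeA τ → ℝ, IsCompleteCharge K α) ∧
    -- the complete ones are exactly those which satisfy the two chains of inequalities
    (∀ α : TypeA τ → ℝ, IsCompleteCharge K α ↔
      (∀ k < TypeA.chi τ (TypeA.vertex τ (Fin.last ℓ)),
        QuiverRep.slope α (TypeA.levelModule K (TypeA.chi τ) k) >
          QuiverRep.slope α (TypeA.levelModule K (TypeA.chi τ) (k + 1))) ∧
      (∀ k < TypeA.eta τ (TypeA.vertex τ (Fin.last ℓ)),
        QuiverRep.slope α (TypeA.levelModule K (TypeA.eta τ) k) <
          QuiverRep.slope α (TypeA.levelModule K (TypeA.eta τ) (k + 1)))) ∧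
    -- the equioriented case
    ((∀ i, τ i = true) → ∀ α : TypeA τ → ℝ, IsCompleteCharge K α ↔
      ∀ i : Fin ℓ, α (TypeA.vertex τ i.castSucc) > α (TypeA.vertex τ i.succ)) := by
  refine ⟨?_, fun α => ?_, fun hτ α => ?_⟩
  · obtain ⟨α, hα⟩ := TypeA.exists_totallyStable τ
    exact ⟨α, hα.isCompleteCharge⟩
  · rw [TypeA.isCompleteCharge_iff, TypeA.totallyStable_iff_slope K]
  · rw [TypeA.isCompleteCharge_iff, TypeA.totallyStable_iff_of_forall_forward hτ]
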